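/- Let $R$ be a commutative ring with unit. For $r\ge 0$, an $r$-bigraded complex is a family of $R$-modules $A=\{A^{p,n}\}_{p,n\in\mathbb{Z}}$ with differentials $d_r\colon A^{p,n}\to A^{p-r,n+1-r}$ satisfying $d_r^2=0$; its homology is $H(A)=\ker d_r/\operatorname{im} d_r$, and a morphism of $r$-bigraded complexes is a quasi-isomorphism if it induces an isomorphism on homology. An extended spectral sequence $(X,\varphi)$ is a family of $r$-bigraded complexes $X_r$, $r\ge 0$, together with morphisms of bigraded $R$-modules $\varphi_{r+1}\colon X_{r+1}\to H(X_r)$ for all $r\ge 0$ (not required to be isomorphisms). A morphism $f\colon X\to Y$ of extended spectral sequences is a family of morphisms $f_r\colon X_r\to Y_r$ of $r$-bigraded complexes, $r\ge 0$, with $H(f_r)\circ\varphi^X_{r+1}=\varphi^Y_{r+1}\circ f_{r+1}$ for all $r\geq 0$. Let $\mathsf{eSpSe}$ denote the category of extended spectral sequences. Theorem. For each $r\ge 0$ there is a model category structure on $\mathsf{eSpSe}$, denoted $\mathsf{eSpSe}'_r$ (that is, $\mathsf{eSpSe}$ has all small limits and colimits, and there are classes of weak equivalences, fibrations and cofibrations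 that satisfy the usual two-out-of-three, retract, lifting and factorization axioms, with both factorizations functorial), such that - the fibrations are exactly the morphisms $f\colon X\to Y$ for which $f_i$ is bidegreewise surjective for all $0\le i\le r$; - the weak equivalences are exactly the morphisms $f\colon X\to Y$ for which $f_r$ is a quasi-isomorphism and $f_i$ is an isomorphism for all $i>r$. -/

import Mathlib

universe u

open CategoryTheory Limits HomotopicalAlgebra

/-- The shape of `r`-bigraded complexes: bidegrees are pairs `(p, n)` of integers and the
differential goes from bidegree `(p, n)` to bidegree `(p - r, n + 1 - r)`. -/
abbrev bigradedShape (r : ℕ) : ComplexShape (ℤ × ℤ) :=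
  ComplexShape.up' (-(r : ℤ), 1 - (r : ℤ))

/-- The category of `r`-bigraded complexes of `R`-modules. -/
abbrev BigradedComplex (R : Type u) [CommRing R] (r : ℕ) : Type (u + 1) :=
  HomologicalComplex (ModuleCat.{u} R) (bigradedShape r)

/-- An extended spectral sequence of `R`-modules: for every `r ≥ 0` an `r`-bigraded complex
`page r`, together with characteristic maps, which are morphisms of bigraded modules from
`page (r + 1)` to the homology of `page r`. -/
structure ExtendedSpectralSequence (R : Type u) [CommRing R] : Type (u + 1) where
  page (r : ℕ) : BigradedComplex R r
  char (r : ℕ) (i : ℤ × ℤ) : (page (r + 1)).X i ⟶ (page r).homology i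

namespace ExtendedSpectralSequence

variable {R : Type u} [CommRing R]

/-- Morphisms of extended spectral sequences: morphisms of `r`-bigraded complexes for all `r`,
compatible with the characteristic maps. -/
@[ext]
structure Hom (X Y : ExtendedSpectralSequence R) : Type u where
  hom (r : ℕ) : X.page r ⟶ Y.page r
  comm (r : ℕ) (i : ℤ × ℤ) :
    X.char r i ≫ HomologicalComplex.homologyMap (hom r) i = (hom (r + 1)).f i ≫ Y.char r i

instance : Category.{u} (ExtendedSpectralSequence R) where
  Hom X Y := Hom X Y
  id X :=
    { hom := fun r => 𝟙 (X.page r)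
      comm := fun r i => by simp }
  comp f g :=
    { hom := fun r => f.hom r ≫ g.hom r
      comm := fun r i => by
        rw [HomologicalComplex.homologyMap_comp, ← Category.assoc, f.comm, Category.assoc,
          g.comm, HomologicalComplex.comp_f, Category.assoc] }
  id_comp f := Hom.ext (funext fun r => Category.id_comp (f.hom r))
  comp_id f := Hom.ext (funext fun r => Category.comp_id (f.hom r))
  assoc f g h := Hom.ext (funext fun r => Category.assoc (f.hom r) (g.hom r) (h.hom r))

/-- The class of morphisms that are bidegreewise surjective on the pages `0, …, r`. -/
def surjectiveUpTo (R : Type u) [CommRing R] (r : ℕ) :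
    MorphismProperty (ExtendedSpectralSequence R) :=
  fun _ _ f => ∀ k : ℕ, k ≤ r → ∀ i : ℤ × ℤ, Function.Surjective ((Hom.hom f k).f i)

/-- The class of morphisms that are a quasi-isomorphism on page `r` and an isomorphism on every
page `s > r`. -/
def quasiIsoIsoAbove (R : Type u) [CommRing R] (r : ℕ) :
    MorphismProperty (ExtendedSpectralSequence R) :=
  fun _ _ f => QuasiIso (Hom.hom f r) ∧ ∀ s : ℕ, r < s → IsIso (Hom.hom f s)

end ExtendedSpectralSequence

/-! The structure is cofibrantly generated. Choosing representatives of characteristic classes page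
by page, an element of page `n` extends to a witness: a sequence on pages `0, …, n` in which each
term represents the characteristic class of the next. Free objects corepresent witnesses: `sphere n`
one that ends in a cycle of page `n`, `disk n` one that ends in any element, together with one for
its differential. Both objects vanish beyond page `n`.

Lifting against `0 → disk n` for all `n ≤ r` is surjectivity on pages `≤ r`
(`rlp_generatingTrivialCofibrations`). Trivial fibrations (`rlp_generatingCofibrations`) are
detected by `0 → disk n` for all `n`, by `sphere r → disk r`, responsible for the quasi-isomorphism
on page `r`, and by `sphere (n + 1) → disk n` for `n ≥ r`, responsible for injectivity on page `n +
1`: the generator may go to `0` there because its representative on page `n` becomes a boundary.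

Colimits are pagewise; homology does not preserve limits, so limits come from the special adjoint
functor theorem. Spheres are small, so the small object argument gives functorial factorizations.
Finally, `exists_factorization` writes any morphism as a weak equivalence followed by a fibration;
hence morphisms with the left lifting property against fibrations are weak equivalences
(`llp_surjectiveUpTo_le`), and the retract argument identifies them with the trivial cofibrations.
-/

namespace HomologicalComplex

variable {R : Type u} [CommRing R] {ι : Type*} {c : ComplexShape ι}

/-! ### Homology classes and their representatives -/

/-- The element `y` is a cycle of `K` in degree `i` that represents the homology class `h`. -/
def Represents (K : HomologicalComplex (ModuleCat.{u} R) c) (i : ι) (y : K.X i)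
    (h : K.homology i) : Prop :=
  ∃ z : K.cycles i, K.iCycles i z = y ∧ K.homologyπ i z = h

variable {K L : HomologicalComplex (ModuleCat.{u} R) c} {i : ι}

lemma iCycles_injective (K : HomologicalComplex (ModuleCat.{u} R) c) (i : ι) :
    Function.Injective (K.iCycles i) :=
  (ModuleCat.mono_iff_injective _).1 inferInstance

lemma exists_represents (h : K.homology i) : ∃ y, K.Represents i y h := by
  obtain ⟨z, hz⟩ := (ModuleCat.epi_iff_surjective (K.homologyπ i)).1 inferInstance h
  exact ⟨_, z, rfl, hz⟩

lemma exists_cycle {y : K.X i} (hy : ∀ j, K.d i j y = 0) : ∃ z : K.cycles i, K.iCycles i z = y := by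
  -- The universal property of cycles is applied to the map from `R` that sends `1` to `y`.
  let k : ModuleCat.of R R ⟶ K.X i := ModuleCat.ofHom (LinearMap.toSpanSingleton R _ y)
  have hk : k ≫ K.d i (c.next i) = 0 := by
    ext
    simp [k, hy]
  refine ⟨K.liftCycles k _ rfl hk (1 : R), ?_⟩
  rw [← ModuleCat.comp_apply, liftCycles_i]
  simp [k]

namespace Represents

lemma exists_of_d_eq_zero {y : K.X i} (hy : ∀ j, K.d i j y = 0) : ∃ h, K.Represents i y h := by
  obtain ⟨z, hz⟩ := exists_cycle hy
  exact ⟨_, z, hz, rfl⟩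

lemma d_eq_zero {y : K.X i} {h : K.homology i} (H : K.Represents i y h) (j : ι) :
    K.d i j y = 0 := by
  obtain ⟨z, rfl, -⟩ := H
  rw [← ModuleCat.comp_apply, iCycles_d]
  rfl

lemma unique {y : K.X i} {h h' : K.homology i} (H : K.Represents i y h)
    (H' : K.Represents i y h') : h = h' := by
  obtain ⟨z, hz, rfl⟩ := H
  obtain ⟨z', hz', rfl⟩ := H'
  rw [K.iCycles_injective i (hz.trans hz'.symm)]

lemma map {y : K.X i} {h : K.homology i} (H : K.Represents i y h) (f : K ⟶ L) :
    L.Represents i (f.f i y) (homologyMap f i h) := by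
  obtain ⟨z, rfl, rfl⟩ := H
  refine ⟨cyclesMap f i z, ?_, ?_⟩
  · rw [← ModuleCat.comp_apply, ← ModuleCat.comp_apply, cyclesMap_i]
  · rw [← ModuleCat.comp_apply, ← ModuleCat.comp_apply, homologyπ_naturality]

lemma sub {y y' : K.X i} {h h' : K.homology i} (H : K.Represents i y h)
    (H' : K.Represents i y' h') : K.Represents i (y - y') (h - h') := by
  obtain ⟨z, rfl, rfl⟩ := H
  obtain ⟨z', rfl, rfl⟩ := H'
  exact ⟨z - z', map_sub _ _ _, map_sub _ _ _⟩

lemma boundary {j : ι} (b : K.X j) : K.Represents i (K.d j i b) 0 := by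
  refine ⟨K.toCycles j i b, ?_, ?_⟩
  · rw [← ModuleCat.comp_apply, toCycles_i]
  · rw [← ModuleCat.comp_apply, toCycles_comp_homologyπ]
    rfl

lemma exists_boundary {y : K.X i} (H : K.Represents i y 0) {j : ι} (hj : c.prev i = j) :
    ∃ b : K.X j, K.d j i b = y := by
  obtain ⟨z, rfl, hz⟩ := H
  have ex := ShortComplex.exact_of_g_is_cokernel
    (ShortComplex.mk _ _ (K.toCycles_comp_homologyπ j i)) (K.homologyIsCokernel j i hj)
  obtain ⟨b, hb⟩ := (ShortComplex.moduleCat_exact_iff _).1 ex z hz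
  refine ⟨b, ?_⟩
  rw [← K.toCycles_i j i, ModuleCat.comp_apply]
  exact congrArg _ hb

lemma sub_boundary {y : K.X i} {h : K.homology i} (H : K.Represents i y h) {j : ι} (b : K.X j) :
    K.Represents i (y - K.d j i b) h := by
  simpa using H.sub (boundary b)

end Represents

lemma d_f_apply (f : K ⟶ L) (i j : ι) (x : K.X i) : L.d i j (f.f i x) = f.f j (K.d i j x) := by
  rw [← ModuleCat.comp_apply, ← ModuleCat.comp_apply, f.comm]

/-- Lifting property of a surjection that is a quasi-isomorphism, in terms of elements. -/
def LiftsBoundaries (f : K ⟶ L) : Prop :=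
  ∀ (i j : ι) (_ : c.Rel i j) (a : K.X j) (b : L.X i), (∀ k, K.d j k a = 0) →
    f.f j a = L.d i j b → ∃ x : K.X i, K.d i j x = a ∧ f.f i x = b

lemma isIso_iff_bijective (f : K ⟶ L) : IsIso f ↔ ∀ i, Function.Bijective (f.f i) := by
  constructor
  · intro _ i
    exact (ConcreteCategory.isIso_iff_bijective (f.f i)).1 inferInstance
  · intro h
    have (i : ι) : IsIso (f.f i) := (ConcreteCategory.isIso_iff_bijective (f.f i)).2 (h i)
    exact Hom.isIso_of_components f

lemma quasiIso_iff_bijective (f : K ⟶ L) :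
    QuasiIso f ↔ ∀ i, Function.Bijective (homologyMap f i) := by
  simp only [quasiIso_iff, quasiIsoAt_iff_isIso_homologyMap, ConcreteCategory.isIso_iff_bijective]

/-- Any representative of `h` maps to `y` up to a boundary; lifting the bounding chain through `f`
corrects it. -/
lemma Represents.exists_lift_of_surjective {f : K ⟶ L} (hf : ∀ i, Function.Surjective (f.f i))
    {h : K.homology i} {y : L.X i} (H : L.Represents i y (homologyMap f i h)) :
    ∃ x, K.Represents i x h ∧ f.f i x = y := by
  obtain ⟨x, hx⟩ := exists_represents h
  have := (hx.map f).sub H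
  rw [sub_self] at this
  obtain ⟨b, hb⟩ := this.exists_boundary rfl
  obtain ⟨b, rfl⟩ := hf _ b
  refine ⟨x - K.d _ _ b, hx.sub_boundary b, ?_⟩
  rw [map_sub, ← d_f_apply, hb]
  simp

lemma liftsBoundaries_of_isIso (f : K ⟶ L) [IsIso f] : LiftsBoundaries f := by
  intro i j _ a b _ h
  have hf := (isIso_iff_bijective f).1 inferInstance
  obtain ⟨x, rfl⟩ := (hf i).2 b
  refine ⟨x, (hf j).1 ?_, rfl⟩
  rw [h, d_f_apply]

/-- Injectivity on homology gives `a = d x`. Then `b - f x` is a cycle, which lifts to a cycle `t`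
by surjectivity on homology and in each degree; the solution is `x + t`. -/
lemma liftsBoundaries_of_quasiIso {f : K ⟶ L} (hf : ∀ i, Function.Surjective (f.f i))
    [hq : QuasiIso f] : LiftsBoundaries f := by
  rw [quasiIso_iff_bijective] at hq
  intro i j hij a b ha h
  obtain ⟨ha', Ha⟩ := Represents.exists_of_d_eq_zero ha
  obtain rfl : ha' = 0 := (hq j).1 (by
    rw [(Ha.map f).unique (h ▸ Represents.boundary b), map_zero])
  obtain ⟨x, rfl⟩ := Ha.exists_boundary (c.prev_eq' hij)
  rw [← d_f_apply] at h
  have hc : ∀ k, L.d i k (b - f.f i x) = 0 := by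
    intro k
    by_cases hk : c.Rel i k
    · obtain rfl := c.next_eq hij hk
      rw [map_sub, h, sub_self]
    · rw [L.shape _ _ hk]; rfl
  obtain ⟨g, hg⟩ := Represents.exists_of_d_eq_zero hc
  obtain ⟨g, rfl⟩ := (hq i).2 g
  obtain ⟨t, ht, ht'⟩ := hg.exists_lift_of_surjective hf
  refine ⟨x + t, ?_, ?_⟩
  · rw [map_add, ht.d_eq_zero, add_zero]
  · rw [map_add, ht']; abel

/-- Injectivity on homology is the case where `b` bounds the image of a cycle `a`; surjectivity is
the case `a = 0`. `LiftsBoundaries` only sees related degrees, so each degree must have a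
predecessor and a successor. -/
lemma quasiIso_of_liftsBoundaries {f : K ⟶ L} (hc : ∀ i, c.Rel (c.prev i) i)
    (hc' : ∀ i, c.Rel i (c.next i)) (h : LiftsBoundaries f) : QuasiIso f := by
  rw [quasiIso_iff_bijective]
  intro i
  constructor
  · rw [injective_iff_map_eq_zero]
    intro g hg
    obtain ⟨x, hx⟩ := exists_represents g
    obtain ⟨b, hb⟩ := (hg ▸ hx.map f).exists_boundary rfl
    obtain ⟨t, rfl, -⟩ := h _ _ (hc i) x b hx.d_eq_zero hb.symm
    exact hx.unique (Represents.boundary t)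
  · intro g
    obtain ⟨y, hy⟩ := exists_represents g
    obtain ⟨x, hx, rfl⟩ := h _ _ (hc' i) 0 y (by simp) (by rw [hy.d_eq_zero, map_zero])
    obtain ⟨t, ht⟩ := Represents.exists_of_d_eq_zero (y := x) (K := K) (by
      intro k
      by_cases hk : c.Rel i k
      · obtain rfl := c.next_eq' hk
        exact hx
      · rw [K.shape _ _ hk]; rfl)
    exact ⟨t, (ht.map f).unique hy⟩

end HomologicalComplex

/-! ### Page functors and pagewise colimits -/

namespace ExtendedSpectralSequence

variable {R : Type u} [CommRing R]

@[ext]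
lemma hom_ext {X Y : ExtendedSpectralSequence R} {f g : X ⟶ Y} (h : ∀ k, Hom.hom f k = Hom.hom g k) :
    f = g :=
  Hom.ext (funext h)

lemma char_map_apply {X Y : ExtendedSpectralSequence R} (f : X ⟶ Y) (k : ℕ) (i : ℤ × ℤ)
    (x : (X.page (k + 1)).X i) :
    Y.char k i ((Hom.hom f (k + 1)).f i x) =
      HomologicalComplex.homologyMap (Hom.hom f k) i (X.char k i x) := by
  rw [← ModuleCat.comp_apply, ← ModuleCat.comp_apply, Hom.comm f]

/-- The functor that sends an extended spectral sequence to its `k`-th page. -/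
@[simps]
def pageFunctor (R : Type u) [CommRing R] (k : ℕ) :
    ExtendedSpectralSequence R ⥤ BigradedComplex R k where
  obj X := X.page k
  map f := Hom.hom f k

/-- The functor that sends an extended spectral sequence to the module in a given bidegree of
a given page. -/
abbrev evalFunctor (R : Type u) [CommRing R] (k : ℕ) (i : ℤ × ℤ) :
    ExtendedSpectralSequence R ⥤ ModuleCat.{u} R :=
  pageFunctor R k ⋙ HomologicalComplex.eval _ _ i

section Colimits

variable {J : Type u} [Category.{u} J] (F : J ⥤ ExtendedSpectralSequence R)

/-- The pages of the colimit. -/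
noncomputable def colimitPage (k : ℕ) : BigradedComplex R k := colimit (F ⋙ pageFunctor R k)

/-- The inclusions into the pages of the colimit. -/
noncomputable def colimitPageι (k : ℕ) (j : J) : (F.obj j).page k ⟶ colimitPage F k :=
  colimit.ι (F ⋙ pageFunctor R k) j

lemma colimitPage_w (k : ℕ) {j j' : J} (f : j ⟶ j') :
    Hom.hom (F.map f) k ≫ colimitPageι F k j' = colimitPageι F k j :=
  colimit.w (F ⋙ pageFunctor R k) f

/-- The universal property of the pages of the colimit. -/
noncomputable def colimitPageDesc (k : ℕ) (s : Cocone F) : colimitPage F k ⟶ s.pt.page k :=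
  colimit.desc (F ⋙ pageFunctor R k) ((pageFunctor R k).mapCocone s)

lemma colimitPageι_desc (k : ℕ) (s : Cocone F) (j : J) :
    colimitPageι F k j ≫ colimitPageDesc F k s = Hom.hom (s.ι.app j) k :=
  colimit.ι_desc _ _

lemma colimitPage_hom_ext {k : ℕ} {K : BigradedComplex R k} {f g : colimitPage F k ⟶ K}
    (h : ∀ j, colimitPageι F k j ≫ f = colimitPageι F k j ≫ g) : f = g :=
  colimit.hom_ext h

/-- The evaluation of the colimit of the pages is a colimit. -/
noncomputable def isColimitEvalPage (k : ℕ) (i : ℤ × ℤ) :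
    IsColimit ((HomologicalComplex.eval _ _ i).mapCocone
      (colimit.cocone (F ⋙ pageFunctor R k))) :=
  isColimitOfPreserves (HomologicalComplex.eval (ModuleCat.{u} R) (bigradedShape k) i)
    (colimit.isColimit _)

lemma colimitPage_eval_hom_ext {k : ℕ} {i : ℤ × ℤ} {M : ModuleCat.{u} R}
    {f g : (colimitPage F k).X i ⟶ M}
    (h : ∀ j, (colimitPageι F k j).f i ≫ f = (colimitPageι F k j).f i ≫ g) : f = g :=
  (isColimitEvalPage F k i).hom_ext h

/-- The characteristic maps, continued to the homology of the colimit page, form a cocone. Homology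
need not commute with colimits for this. -/
lemma colimitChar_naturality (k : ℕ) (i : ℤ × ℤ) {j j' : J} (f : j ⟶ j') :
    (Hom.hom (F.map f) (k + 1)).f i ≫ (F.obj j').char k i ≫
        HomologicalComplex.homologyMap (colimitPageι F k j') i =
      (F.obj j).char k i ≫ HomologicalComplex.homologyMap (colimitPageι F k j) i := by
  rw [← Category.assoc, ← Hom.comm, Category.assoc, ← HomologicalComplex.homologyMap_comp,
    colimitPage_w]

/-- The characteristic maps of the colimit. -/
noncomputable def colimitChar (k : ℕ) (i : ℤ × ℤ) :
    (colimitPage F (k + 1)).X i ⟶ (colimitPage F k).homology i :=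
  (isColimitEvalPage F (k + 1) i).desc
    (Cocone.mk ((colimitPage F k).homology i)
      { app := fun j => (F.obj j).char k i ≫
          HomologicalComplex.homologyMap (colimitPageι F k j) i
        naturality := fun _ _ f =>
          (colimitChar_naturality F k i f).trans (Category.comp_id _).symm })

lemma ι_colimitChar (k : ℕ) (i : ℤ × ℤ) (j : J) :
    (colimitPageι F (k + 1) j).f i ≫ colimitChar F k i =
      (F.obj j).char k i ≫ HomologicalComplex.homologyMap (colimitPageι F k j) i :=
  (isColimitEvalPage F (k + 1) i).fac _ j

/-- The colimit of extended spectral sequences, computed page by page. -/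
noncomputable def colimitObj : ExtendedSpectralSequence R where
  page := colimitPage F
  char := colimitChar F

/-- The inclusions into the colimit. -/
noncomputable def colimitObjι (j : J) : F.obj j ⟶ colimitObj F :=
  Hom.mk (fun k => colimitPageι F k j) (fun k i => (ι_colimitChar F k i j).symm)

/-- The colimit cocone of extended spectral sequences, computed page by page. -/
noncomputable def colimitCocone : Cocone F where
  pt := colimitObj F
  ι :=
    { app := colimitObjι F
      naturality := fun _ _ f => (hom_ext fun k => colimitPage_w F k f).trans
        (Category.comp_id _).symm }

lemma colimitPageDesc_comm (s : Cocone F) (k : ℕ) (i : ℤ × ℤ) :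
    colimitChar F k i ≫ HomologicalComplex.homologyMap (colimitPageDesc F k s) i =
      (colimitPageDesc F (k + 1) s).f i ≫ s.pt.char k i := by
  refine colimitPage_eval_hom_ext F fun j => ?_
  rw [← Category.assoc, ι_colimitChar, Category.assoc, ← HomologicalComplex.homologyMap_comp,
    colimitPageι_desc, ← Category.assoc, ← HomologicalComplex.comp_f, colimitPageι_desc]
  exact Hom.comm (s.ι.app j) k i

/-- The universal morphism out of the colimit. -/
noncomputable def colimitObjDesc (s : Cocone F) : colimitObj F ⟶ s.pt :=
  Hom.mk (fun k => colimitPageDesc F k s) (colimitPageDesc_comm F s)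

/-- The colimit cocone computed page by page is a colimit. -/
noncomputable def isColimitColimitCocone : IsColimit (colimitCocone F) where
  desc := colimitObjDesc F
  fac s j := hom_ext fun k => colimitPageι_desc F k s j
  uniq s _ h := hom_ext fun k => colimitPage_hom_ext F fun j =>
    (congrArg (fun f => Hom.hom f k) (h j)).trans (colimitPageι_desc F k s j).symm

instance : HasColimits (ExtendedSpectralSequence R) :=
  ⟨fun _ _ => ⟨fun F => ⟨⟨⟨_, isColimitColimitCocone F⟩⟩⟩⟩⟩

noncomputable instance (k : ℕ) : PreservesColimits (pageFunctor R k) :=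
  ⟨⟨fun {F} => preservesColimit_of_preserves_colimit_cocone (isColimitColimitCocone F)
    (colimit.isColimit (F ⋙ pageFunctor R k))⟩⟩

end Colimits

lemma surjective_of_epi {X Y : ExtendedSpectralSequence R} (f : X ⟶ Y) [Epi f] (k : ℕ)
    (i : ℤ × ℤ) : Function.Surjective ((Hom.hom f k).f i) :=
  (ModuleCat.epi_iff_surjective _).1 (inferInstanceAs (Epi ((evalFunctor R k i).map f)))

end ExtendedSpectralSequence

/-! ### Free extended spectral sequences -/

namespace ExtendedSpectralSequence

/-- Combinatorial data for a free extended spectral sequence whose last nonzero page is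
page `n`: sets of generators in all bidegrees and a differential between them, which is the
differential of page `n`. -/
structure CellData (n : ℕ) where
  gen : ℤ × ℤ → Type
  diff (i j : ℤ × ℤ) : gen i → Option (gen j)
  rel (i j : ℤ × ℤ) (g : gen i) : diff i j g ≠ none → (bigradedShape n).Rel i j
  diff_diff (i j k : ℤ × ℤ) (g : gen i) (g' : gen j) : diff i j g = some g' → diff j k g' = none

namespace CellData

variable {n : ℕ} (D : CellData n) (R : Type u) [CommRing R]

/-- The underlying modules of the free extended spectral sequence. -/
noncomputable abbrev obj (m : ℕ) (i : ℤ × ℤ) : ModuleCat.{u} R :=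
  -- For `m > n` the index type is empty, so the page is zero.
  ModuleCat.of R ({_g : D.gen i // m ≤ n} →₀ R)

variable {R} in
/-- The linear map given by values on generators. -/
noncomputable def lift (m : ℕ) {i : ℤ × ℤ} {M : ModuleCat.{u} R} (φ : D.gen i → M) :
    D.obj R m i ⟶ M :=
  ModuleCat.ofHom (Finsupp.linearCombination R fun g => φ g.1)

/-- The generators as elements of page `m`, which vanish for `m > n`. -/
noncomputable def basis (m : ℕ) {i : ℤ × ℤ} (g : D.gen i) : D.obj R m i := by
  classical
  exact if h : m ≤ n then Finsupp.single ⟨g, h⟩ 1 else 0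

variable {R} in
lemma lift_basis {m : ℕ} {i : ℤ × ℤ} {M : ModuleCat.{u} R} (φ : D.gen i → M) (g : D.gen i)
    (h : m ≤ n) : D.lift m φ (D.basis R m g) = φ g := by
  simp [lift, basis, h]

lemma basis_eq_zero {m : ℕ} {i : ℤ × ℤ} (g : D.gen i) (h : n < m) : D.basis R m g = 0 :=
  dif_neg (not_le.2 h)

variable {R} in
lemma obj_hom_ext {m : ℕ} {i : ℤ × ℤ} {M : ModuleCat.{u} R} {f f' : D.obj R m i ⟶ M}
    (h : m ≤ n → ∀ g : D.gen i, f (D.basis R m g) = f' (D.basis R m g)) : f = f' := by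
  apply ModuleCat.hom_ext
  apply Finsupp.lhom_ext'
  rintro ⟨g, hm⟩
  ext
  simpa [basis, hm] using h hm g

/-- The (optional) generators as elements of page `m`. -/
noncomputable def basis' (m : ℕ) {i : ℤ × ℤ} (g : Option (D.gen i)) : D.obj R m i :=
  g.elim 0 (D.basis R m)

open Classical in
/-- The differentials of the free extended spectral sequence. -/
noncomputable def d (m : ℕ) (i j : ℤ × ℤ) : D.obj R m i ⟶ D.obj R m j :=
  -- Below page `n` every generator is a cycle, so it can represent the generator of the next page.
  D.lift m fun g => if m = n then D.basis' R m (D.diff i j g) else 0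

lemma d_basis_of_lt {m : ℕ} (h : m < n) {i : ℤ × ℤ} (j : ℤ × ℤ) (g : D.gen i) :
    D.d R m i j (D.basis R m g) = 0 := by
  rw [d, lift_basis _ _ _ h.le, if_neg h.ne]

lemma d_basis {i : ℤ × ℤ} (j : ℤ × ℤ) (g : D.gen i) :
    D.d R n i j (D.basis R n g) = D.basis' R n (D.diff i j g) := by
  rw [d, lift_basis _ _ _ le_rfl, if_pos rfl]

/-- The pages of the free extended spectral sequence. -/
noncomputable def page (m : ℕ) : BigradedComplex R m where
  X := D.obj R m
  d := D.d R m
  shape i j hij := by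
    refine D.obj_hom_ext fun hm g => ?_
    obtain hm | rfl := hm.lt_or_eq
    · rw [d_basis_of_lt _ _ hm]; rfl
    · rw [d_basis, not_not.1 (mt (D.rel i j g) hij)]; rfl
  d_comp_d' i j k _ _ := by
    refine D.obj_hom_ext fun hm g => ?_
    rw [ModuleCat.comp_apply]
    obtain hm | rfl := hm.lt_or_eq
    · rw [d_basis_of_lt _ _ hm, map_zero]; rfl
    · rw [d_basis]
      cases hg : D.diff i j g with
      | none => exact map_zero _
      | some g' =>
        change D.d R m j k (D.basis R m g') = 0
        rw [d_basis, D.diff_diff i j k g g' hg]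
        rfl

/-- The map that sends generators of page `m + 1` to the corresponding generators of page `m`. -/
noncomputable def shift (m : ℕ) (i : ℤ × ℤ) : D.obj R (m + 1) i ⟶ D.obj R m i :=
  D.lift (m + 1) (D.basis R m)

lemma shift_d (m : ℕ) (i j : ℤ × ℤ) : D.shift R m i ≫ D.d R m i j = 0 := by
  refine D.obj_hom_ext fun hm g => ?_
  rw [ModuleCat.comp_apply, shift, lift_basis _ _ _ hm]
  exact D.d_basis_of_lt R hm j g

/-- The map that sends generators of page `m + 1` to the corresponding cycles of page `m`. -/
noncomputable def shiftCycles (m : ℕ) (i : ℤ × ℤ) : D.obj R (m + 1) i ⟶ (D.page R m).cycles i :=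
  (D.page R m).liftCycles (D.shift R m i) _ rfl (D.shift_d R m i _)

lemma iCycles_shiftCycles_basis {m : ℕ} (hm : m < n) {i : ℤ × ℤ} (g : D.gen i) :
    (D.page R m).iCycles i (D.shiftCycles R m i (D.basis R (m + 1) g)) = D.basis R m g := by
  have h : D.shiftCycles R m i ≫ (D.page R m).iCycles i = D.shift R m i :=
    (D.page R m).liftCycles_i _ _ _ _
  rw [← ModuleCat.comp_apply, h]
  exact D.lift_basis _ _ hm

/-- The free extended spectral sequence. -/
noncomputable def free : ExtendedSpectralSequence R where
  page := D.page R
  char m i := D.shiftCycles R m i ≫ (D.page R m).homologyπ i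

/-- The generators of the free extended spectral sequence. -/
noncomputable def elt (m : ℕ) {i : ℤ × ℤ} (g : D.gen i) : ((D.free R).page m).X i :=
  D.basis R m g

lemma elt_eq_zero {m : ℕ} {i : ℤ × ℤ} (g : D.gen i) (h : n < m) : D.elt R m g = 0 :=
  D.basis_eq_zero R g h

lemma d_elt_of_lt {m : ℕ} (h : m < n) {i : ℤ × ℤ} (j : ℤ × ℤ) (g : D.gen i) :
    ((D.free R).page m).d i j (D.elt R m g) = 0 :=
  D.d_basis_of_lt R h j g

lemma d_elt {i : ℤ × ℤ} (j : ℤ × ℤ) (g : D.gen i) :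
    ((D.free R).page n).d i j (D.elt R n g) = (D.diff i j g).elim 0 (D.elt R n) :=
  D.d_basis R j g

lemma represents_elt {m : ℕ} (hm : m < n) {i : ℤ × ℤ} (g : D.gen i) :
    ((D.free R).page m).Represents i (D.elt R m g)
      ((D.free R).char m i (D.elt R (m + 1) g)) :=
  ⟨D.shiftCycles R m i (D.basis R (m + 1) g), D.iCycles_shiftCycles_basis R hm g, rfl⟩

variable {R}

lemma free_obj_hom_ext {m : ℕ} {i : ℤ × ℤ} {M : ModuleCat.{u} R}
    {f f' : ((D.free R).page m).X i ⟶ M}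
    (h : m ≤ n → ∀ g : D.gen i, f (D.elt R m g) = f' (D.elt R m g)) : f = f' :=
  D.obj_hom_ext h

/-- The linear map out of a module of the free extended spectral sequence given by values on
generators. -/
noncomputable def freeLift (m : ℕ) {i : ℤ × ℤ} {M : ModuleCat.{u} R} (φ : D.gen i → M) :
    ((D.free R).page m).X i ⟶ M :=
  D.lift m φ

lemma freeLift_elt {m : ℕ} {i : ℤ × ℤ} {M : ModuleCat.{u} R} (φ : D.gen i → M) (g : D.gen i)
    (h : m ≤ n) : D.freeLift m φ (D.elt R m g) = φ g :=
  D.lift_basis φ g h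

variable {X : ExtendedSpectralSequence R}

lemma hom_ext {f f' : D.free R ⟶ X}
    (h : ∀ m ≤ n, ∀ i (g : D.gen i),
      (Hom.hom f m).f i (D.elt R m g) = (Hom.hom f' m).f i (D.elt R m g)) : f = f' := by
  ext m i : 2
  exact D.free_obj_hom_ext fun hm g => h m hm i g

/-- Families of elements of an extended spectral sequence that are the images of the generators
under a morphism from a free extended spectral sequence. -/
structure IsFamily (x : ∀ (m : ℕ) (i : ℤ × ℤ), D.gen i → (X.page m).X i) : Prop where
  d_eq (i j : ℤ × ℤ) (g : D.gen i) :
    (X.page n).d i j (x n i g) = (D.diff i j g).elim 0 (x n j)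
  represents (m : ℕ) (hm : m < n) (i : ℤ × ℤ) (g : D.gen i) :
    (X.page m).Represents i (x m i g) (X.char m i (x (m + 1) i g))

variable {x : ∀ (m : ℕ) (i : ℤ × ℤ), D.gen i → (X.page m).X i}

/-- The morphism of complexes given by a family of elements. -/
noncomputable def descPage (hx : D.IsFamily x) (m : ℕ) : (D.free R).page m ⟶ X.page m where
  f i := D.freeLift m (x m i)
  comm' i j _ := by
    refine D.free_obj_hom_ext fun hm g => ?_
    rw [ModuleCat.comp_apply, ModuleCat.comp_apply, freeLift_elt _ _ _ hm]
    obtain hm' | rfl := hm.lt_or_eq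
    · rw [d_elt_of_lt _ _ hm', map_zero, (hx.represents m hm' i g).d_eq_zero]
    · rw [d_elt, hx.d_eq]
      cases D.diff i j g with
      | none => exact (map_zero _).symm
      | some g' => exact (freeLift_elt _ _ _ le_rfl).symm

lemma descPage_elt (hx : D.IsFamily x) {m : ℕ} (hm : m ≤ n) {i : ℤ × ℤ} (g : D.gen i) :
    (D.descPage hx m).f i (D.elt R m g) = x m i g :=
  D.freeLift_elt _ _ hm

/-- The morphism from a free extended spectral sequence given by a family of elements. -/
noncomputable def desc (hx : D.IsFamily x) : D.free R ⟶ X :=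
  Hom.mk (D.descPage hx) fun m i => D.free_obj_hom_ext fun hm g => by
    rw [ModuleCat.comp_apply, ModuleCat.comp_apply, descPage_elt _ _ hm]
    refine ((D.represents_elt R hm g).map (D.descPage hx m)).unique ?_
    rw [descPage_elt _ _ (Nat.le_of_succ_le hm)]
    exact hx.represents m hm i g

lemma desc_elt (hx : D.IsFamily x) {m : ℕ} (hm : m ≤ n) {i : ℤ × ℤ} (g : D.gen i) :
    (Hom.hom (D.desc hx) m).f i (D.elt R m g) = x m i g :=
  D.descPage_elt hx hm g

end CellData

end ExtendedSpectralSequence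

/-! ### Witness sequences, spheres and disks -/

namespace ExtendedSpectralSequence

variable {R : Type u} [CommRing R]

/-- In the sequence `y`, the element of page `m` represents the characteristic class of the element
of page `m + 1`, for all `m < n`. -/
def IsWitness (X : ExtendedSpectralSequence R) (n : ℕ) (i : ℤ × ℤ)
    (y : ∀ m, (X.page m).X i) : Prop :=
  ∀ m < n, (X.page m).Represents i (y m) (X.char m i (y (m + 1)))

lemma IsWitness.map {X Y : ExtendedSpectralSequence R} {n : ℕ} {i : ℤ × ℤ}
    {y : ∀ m, (X.page m).X i} (hy : X.IsWitness n i y) (f : X ⟶ Y) :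
    Y.IsWitness n i fun m => (Hom.hom f m).f i (y m) := fun m hm => by
  rw [char_map_apply]
  exact (hy m hm).map _

/-- Representatives are chosen downwards from page `n`, keeping the condition `P` at every choice.
Terms beyond page `n` are arbitrary. -/
lemma exists_isWitness_of_step {X : ExtendedSpectralSequence R} {i : ℤ × ℤ}
    (P : ∀ m, (X.page m).X i → Prop) (n : ℕ)
    (hP : ∀ m < n, ∀ x, P (m + 1) x →
      ∃ x', P m x' ∧ (X.page m).Represents i x' (X.char m i x))
    (x : (X.page n).X i) (hx : P n x) :
    ∃ y : ∀ m, (X.page m).X i, X.IsWitness n i y ∧ y n = x ∧ ∀ m ≤ n, P m (y m) := by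
  induction n with
  | zero =>
    refine ⟨Function.update (fun _ => 0) 0 x, fun m hm => (Nat.not_lt_zero m hm).elim, by simp, ?_⟩
    intro m hm
    obtain rfl := Nat.le_zero.1 hm
    simpa using hx
  | succ n ih =>
    obtain ⟨x', hx', H⟩ := hP n n.lt_succ_self x hx
    obtain ⟨y, hy, hyn, hyP⟩ := ih (fun m hm => hP m (hm.trans n.lt_succ_self)) x' hx'
    have hu (m : ℕ) (hm : m ≤ n) : Function.update y (n + 1) x m = y m :=
      Function.update_of_ne (by omega) _ _
    refine ⟨Function.update y (n + 1) x, fun m hm => ?_, by simp, fun m hm => ?_⟩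
    · obtain hm | rfl := (Nat.le_of_lt_succ hm).lt_or_eq
      · rw [hu m hm.le, hu (m + 1) hm]
        exact hy m hm
      · rw [hu m le_rfl, Function.update_self, hyn]
        exact H
    · obtain hm | rfl := hm.lt_or_eq
      · rw [hu m (Nat.le_of_lt_succ hm)]
        exact hyP m (Nat.le_of_lt_succ hm)
      · simpa using hx

lemma exists_isWitness {X : ExtendedSpectralSequence R} {n : ℕ} {i : ℤ × ℤ} (x : (X.page n).X i) :
    ∃ y : ∀ m, (X.page m).X i, X.IsWitness n i y ∧ y n = x := by
  obtain ⟨y, hy, hyn, -⟩ := exists_isWitness_of_step (X := X) (fun _ _ => True) n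
    (fun m _ x _ => by simpa using HomologicalComplex.exists_represents (X.char m i x)) x trivial
  exact ⟨y, hy, hyn⟩

/-- The lift on page `n` is given, so surjectivity is needed only strictly below it. -/
lemma IsWitness.exists_lift {X Y : ExtendedSpectralSequence R} {n : ℕ} {i : ℤ × ℤ} {f : X ⟶ Y}
    (hf : ∀ m < n, ∀ i, Function.Surjective ((Hom.hom f m).f i))
    {y : ∀ m, (Y.page m).X i} (hy : Y.IsWitness n i y)
    (x : (X.page n).X i) (hx : (Hom.hom f n).f i x = y n) :
    ∃ x' : ∀ m, (X.page m).X i, X.IsWitness n i x' ∧ x' n = x ∧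
      ∀ m ≤ n, (Hom.hom f m).f i (x' m) = y m := by
  refine exists_isWitness_of_step (X := X) (fun m x => (Hom.hom f m).f i x = y m) n ?_ x hx
  intro m hm x hx
  have H := hy m hm
  rw [← hx, char_map_apply] at H
  obtain ⟨x', h, h'⟩ := H.exists_lift_of_surjective (hf m hm)
  exact ⟨x', h', h⟩

/-- The generator of a sphere. -/
inductive SphereGen (i : ℤ × ℤ) : ℤ × ℤ → Type
  | cycle : SphereGen i i

/-- The target of the differential of page `n` in bidegree `i`. -/
def nextBidegree (n : ℕ) (i : ℤ × ℤ) : ℤ × ℤ := i + (-(n : ℤ), 1 - (n : ℤ))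

lemma rel_nextBidegree (n : ℕ) (i : ℤ × ℤ) : (bigradedShape n).Rel i (nextBidegree n i) := rfl

lemma exists_nextBidegree (n : ℕ) (i : ℤ × ℤ) : ∃ j, nextBidegree n j = i :=
  ⟨i - (-(n : ℤ), 1 - (n : ℤ)), sub_add_cancel _ _⟩

lemma rel_prev (r : ℕ) (i : ℤ × ℤ) : (bigradedShape r).Rel ((bigradedShape r).prev i) i := by
  obtain ⟨j, rfl⟩ := exists_nextBidegree r i
  rw [ComplexShape.prev_eq' _ (rel_nextBidegree r j)]
  exact rel_nextBidegree r j

lemma rel_next (r : ℕ) (i : ℤ × ℤ) : (bigradedShape r).Rel i ((bigradedShape r).next i) := by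
  rw [ComplexShape.next_eq' _ (rel_nextBidegree r i)]
  exact rel_nextBidegree r i

/-- The generators of a disk. -/
inductive DiskGen (n : ℕ) (i : ℤ × ℤ) : ℤ × ℤ → Type
  | chain : DiskGen n i i
  | boundary : DiskGen n i (nextBidegree n i)

/-- The differential of a disk. -/
def DiskGen.diff (n : ℕ) (i : ℤ × ℤ) (j k : ℤ × ℤ) : DiskGen n i j → Option (DiskGen n i k)
  | .chain => if h : nextBidegree n i = k then some (h ▸ .boundary) else none
  | .boundary => none

lemma DiskGen.diff_chain (n : ℕ) (i : ℤ × ℤ) :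
    DiskGen.diff n i i (nextBidegree n i) .chain = some .boundary :=
  dif_pos rfl

lemma DiskGen.diff_chain_of_ne {n : ℕ} {i k : ℤ × ℤ} (h : nextBidegree n i ≠ k) :
    DiskGen.diff n i i k .chain = none :=
  dif_neg h

/-- A cycle in bidegree `i` on page `n`. -/
@[simps]
def sphereData (n : ℕ) (i : ℤ × ℤ) : CellData n where
  gen := SphereGen i
  diff _ _ _ := none
  rel _ _ _ h := (h rfl).elim
  diff_diff _ _ _ _ _ _ := rfl

/-- An element in bidegree `i` on page `n` together with its differential. -/
@[simps]
def diskData (n : ℕ) (i : ℤ × ℤ) : CellData n where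
  gen := DiskGen n i
  diff := DiskGen.diff n i
  rel j k g h := by
    cases g with
    | chain =>
      by_cases hk : nextBidegree n i = k
      · exact hk
      · simp [DiskGen.diff, hk] at h
    | boundary => simp [DiskGen.diff] at h
  diff_diff j k l g g' h := by
    cases g with
    | chain =>
      by_cases hk : nextBidegree n i = k
      · subst hk
        simp only [DiskGen.diff, dite_true, Option.some.injEq] at h
        subst h
        rfl
      · simp [DiskGen.diff, hk] at h
    | boundary => simp [DiskGen.diff] at h

/-- The free extended spectral sequence on a cycle of page `n`. -/
noncomputable abbrev sphere (R : Type u) [CommRing R] (n : ℕ) (i : ℤ × ℤ) :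
    ExtendedSpectralSequence R :=
  (sphereData n i).free R

/-- The free extended spectral sequence on an element of page `n`. -/
noncomputable abbrev disk (R : Type u) [CommRing R] (n : ℕ) (i : ℤ × ℤ) :
    ExtendedSpectralSequence R :=
  (diskData n i).free R

variable (R) in
/-- The generator of a sphere, on page `m`. -/
noncomputable def sphereElt (n : ℕ) (i : ℤ × ℤ) (m : ℕ) : ((sphere R n i).page m).X i :=
  (sphereData n i).elt R m .cycle

variable (R) in
/-- The generating chain of a disk, on page `m`. -/
noncomputable def diskElt (n : ℕ) (i : ℤ × ℤ) (m : ℕ) : ((disk R n i).page m).X i :=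
  (diskData n i).elt R m .chain

variable (R) in
/-- The generating boundary of a disk, on page `m`. -/
noncomputable def diskBoundary (n : ℕ) (i : ℤ × ℤ) (m : ℕ) :
    ((disk R n i).page m).X (nextBidegree n i) :=
  (diskData n i).elt R m .boundary

section

variable {X : ExtendedSpectralSequence R} {n : ℕ} {i : ℤ × ℤ}

lemma sphere_hom_ext {f f' : sphere R n i ⟶ X}
    (h : ∀ m ≤ n, (Hom.hom f m).f i (sphereElt R n i m) = (Hom.hom f' m).f i (sphereElt R n i m)) :
    f = f' := by
  refine (sphereData n i).hom_ext ?_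
  rintro m hm _ ⟨⟩
  exact h m hm

lemma isWitness_sphereElt : (sphere R n i).IsWitness n i (sphereElt R n i) :=
  fun _ hm => (sphereData n i).represents_elt R hm .cycle

lemma d_sphereElt (j : ℤ × ℤ) : ((sphere R n i).page n).d i j (sphereElt R n i n) = 0 :=
  (sphereData n i).d_elt R j .cycle

lemma sphere_isFamily {y : ∀ m, (X.page m).X i} (hy : X.IsWitness n i y)
    (hd : ∀ j, (X.page n).d i j (y n) = 0) :
    (sphereData n i).IsFamily (X := X) (fun m _ g => match g with | .cycle => y m) where
  d_eq := by rintro _ j ⟨⟩; exact hd j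
  represents := by rintro m hm _ ⟨⟩; exact hy m hm

/-- The morphism out of a sphere given by a cycle and a witness sequence. -/
noncomputable def sphereDesc {y : ∀ m, (X.page m).X i} (hy : X.IsWitness n i y)
    (hd : ∀ j, (X.page n).d i j (y n) = 0) : sphere R n i ⟶ X :=
  (sphereData n i).desc (sphere_isFamily hy hd)

lemma sphereDesc_elt {y : ∀ m, (X.page m).X i} (hy : X.IsWitness n i y)
    (hd : ∀ j, (X.page n).d i j (y n) = 0) {m : ℕ} (hm : m ≤ n) :
    (Hom.hom (sphereDesc hy hd) m).f i (sphereElt R n i m) = y m :=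
  (sphereData n i).desc_elt _ hm .cycle

lemma disk_hom_ext {f f' : disk R n i ⟶ X}
    (h : ∀ m ≤ n, (Hom.hom f m).f _ (diskElt R n i m) = (Hom.hom f' m).f _ (diskElt R n i m))
    (h' : ∀ m ≤ n, (Hom.hom f m).f _ (diskBoundary R n i m) =
      (Hom.hom f' m).f _ (diskBoundary R n i m)) :
    f = f' := by
  refine (diskData n i).hom_ext ?_
  rintro m hm _ ⟨⟩
  exacts [h m hm, h' m hm]

lemma isWitness_diskElt : (disk R n i).IsWitness n i (diskElt R n i) :=
  fun _ hm => (diskData n i).represents_elt R hm .chain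

lemma isWitness_diskBoundary :
    (disk R n i).IsWitness n (nextBidegree n i) (diskBoundary R n i) :=
  fun _ hm => (diskData n i).represents_elt R hm .boundary

lemma d_diskElt :
    ((disk R n i).page n).d i (nextBidegree n i) (diskElt R n i n) = diskBoundary R n i n :=
  (diskData n i).d_elt R _ .chain |>.trans
    (congrArg (Option.elim · 0 ((diskData n i).elt R n)) (DiskGen.diff_chain n i))

lemma d_diskBoundary (j : ℤ × ℤ) :
    ((disk R n i).page n).d _ j (diskBoundary R n i n) = 0 :=
  (diskData n i).d_elt R j .boundary

lemma diskBoundary_eq_zero {m : ℕ} (hm : n < m) : diskBoundary R n i m = 0 :=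
  (diskData n i).elt_eq_zero R .boundary hm

/-- The family of elements indexed by the generators of a disk. -/
def diskFamily (b : ∀ m, (X.page m).X i) (y : ∀ m, (X.page m).X (nextBidegree n i)) (m : ℕ)
    (j : ℤ × ℤ) : DiskGen n i j → (X.page m).X j
  | .chain => b m
  | .boundary => y m

lemma disk_isFamily {b : ∀ m, (X.page m).X i} {y : ∀ m, (X.page m).X (nextBidegree n i)}
    (hb : X.IsWitness n i b) (hy : X.IsWitness n (nextBidegree n i) y)
    (hd : (X.page n).d i (nextBidegree n i) (b n) = y n) :
    (diskData n i).IsFamily (X := X)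
      (diskFamily b y) where
  d_eq := by
    rintro _ j ⟨⟩
    · by_cases h : nextBidegree n i = j
      · subst h
        exact hd.trans (congrArg (Option.elim · 0 (diskFamily b y n _)) (DiskGen.diff_chain n i)).symm
      · refine Eq.trans ?_ (congrArg (Option.elim · 0 _) (DiskGen.diff_chain_of_ne h)).symm
        rw [(X.page n).shape _ _ h]
        rfl
    · change (X.page n).d _ j (y n) = 0
      rw [← hd, ← ModuleCat.comp_apply, HomologicalComplex.d_comp_d]
      rfl
  represents := by
    rintro m hm _ ⟨⟩
    exacts [hb m hm, hy m hm]

/-- The morphism out of a disk given by an element with its differential and witness sequences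
for both. -/
noncomputable def diskDesc {b : ∀ m, (X.page m).X i} {y : ∀ m, (X.page m).X (nextBidegree n i)}
    (hb : X.IsWitness n i b) (hy : X.IsWitness n (nextBidegree n i) y)
    (hd : (X.page n).d i (nextBidegree n i) (b n) = y n) : disk R n i ⟶ X :=
  (diskData n i).desc (disk_isFamily hb hy hd)

section

variable {b : ∀ m, (X.page m).X i} {y : ∀ m, (X.page m).X (nextBidegree n i)}
    (hb : X.IsWitness n i b) (hy : X.IsWitness n (nextBidegree n i) y)
    (hd : (X.page n).d i (nextBidegree n i) (b n) = y n)

lemma diskDesc_elt {m : ℕ} (hm : m ≤ n) :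
    (Hom.hom (diskDesc hb hy hd) m).f i (diskElt R n i m) = b m :=
  (diskData n i).desc_elt _ hm .chain

lemma diskDesc_boundary {m : ℕ} (hm : m ≤ n) :
    (Hom.hom (diskDesc hb hy hd) m).f _ (diskBoundary R n i m) = y m :=
  (diskData n i).desc_elt _ hm .boundary

end

/-- Disks thus detect all elements, which serves both for surjectivity and for separation. -/
lemma exists_disk_hom (x : (X.page n).X i) :
    ∃ f : disk R n i ⟶ X, (Hom.hom f n).f i (diskElt R n i n) = x := by
  obtain ⟨b, hb, rfl⟩ := exists_isWitness x
  obtain ⟨y, hy, h⟩ := exists_isWitness ((X.page n).d i (nextBidegree n i) (b n))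
  exact ⟨diskDesc hb hy h.symm, diskDesc_elt _ _ _ le_rfl⟩

end

variable (R) in
/-- The inclusion of the boundary sphere into a disk. -/
noncomputable def sphereToDisk (n : ℕ) (i : ℤ × ℤ) : sphere R n (nextBidegree n i) ⟶ disk R n i :=
  sphereDesc isWitness_diskBoundary d_diskBoundary

/-- The sequence extends by `0` to page `n + 1`: on page `n` its term is the differential of the
chain, so it represents the zero class. -/
lemma isWitness_diskBoundary_succ (n : ℕ) (i : ℤ × ℤ) :
    (disk R n i).IsWitness (n + 1) (nextBidegree n i) (diskBoundary R n i) := by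
  intro m hm
  obtain hm | rfl := (Nat.le_of_lt_succ hm).lt_or_eq
  · exact isWitness_diskBoundary m hm
  · rw [diskBoundary_eq_zero m.lt_succ_self, map_zero, ← d_diskElt]
    exact HomologicalComplex.Represents.boundary _

variable (R) in
/-- The morphism from a sphere that kills its generator on the last page by making its
characteristic class vanish. -/
noncomputable def sphereSuccToDisk (n : ℕ) (i : ℤ × ℤ) :
    sphere R (n + 1) (nextBidegree n i) ⟶ disk R n i :=
  sphereDesc (isWitness_diskBoundary_succ n i) fun j => by
    rw [diskBoundary_eq_zero n.lt_succ_self, map_zero]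

lemma sphereToDisk_elt (n : ℕ) (i : ℤ × ℤ) {m : ℕ} (hm : m ≤ n) :
    (Hom.hom (sphereToDisk R n i) m).f _ (sphereElt R n _ m) = diskBoundary R n i m :=
  sphereDesc_elt _ _ hm

lemma sphereSuccToDisk_elt (n : ℕ) (i : ℤ × ℤ) {m : ℕ} (hm : m ≤ n + 1) :
    (Hom.hom (sphereSuccToDisk R n i) m).f _ (sphereElt R (n + 1) _ m) = diskBoundary R n i m :=
  sphereDesc_elt _ _ hm

end ExtendedSpectralSequence

/-! ### Lifting properties and generating sets -/

namespace ExtendedSpectralSequence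

variable {R : Type u} [CommRing R] {X Y : ExtendedSpectralSequence R} {f : X ⟶ Y}

lemma hom_comp_apply {X Y Z : ExtendedSpectralSequence R} (f : X ⟶ Y) (g : Y ⟶ Z) (k : ℕ)
    (i : ℤ × ℤ) (x : (X.page k).X i) :
    (Hom.hom (f ≫ g) k).f i x = (Hom.hom g k).f i ((Hom.hom f k).f i x) := rfl

lemma surjective_of_hasLiftingProperty {n : ℕ} {i : ℤ × ℤ}
    [HasLiftingProperty (initial.to (disk R n i)) f] : Function.Surjective ((Hom.hom f n).f i) := by
  intro y
  obtain ⟨g, rfl⟩ := exists_disk_hom y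
  have sq : CommSq (initial.to X) (initial.to (disk R n i)) f g :=
    ⟨initialIsInitial.hom_ext _ _⟩
  exact ⟨(Hom.hom sq.lift n).f i (diskElt R n i n), by rw [← hom_comp_apply, sq.fac_right]⟩

/-- Page `n` lifts the chain to some `b`; the lower pages lift its witness and, starting from `d b`,
that of the boundary. -/
lemma hasLiftingProperty_initial_to_disk {n : ℕ} (i : ℤ × ℤ)
    (hf : ∀ m ≤ n, ∀ i, Function.Surjective ((Hom.hom f m).f i)) :
    HasLiftingProperty (initial.to (disk R n i)) f where
  sq_hasLift {t g} _ := by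
    have hf' (m : ℕ) (hm : m < n) := hf m hm.le
    obtain ⟨b, hb⟩ := hf n le_rfl i ((Hom.hom g n).f i (diskElt R n i n))
    obtain ⟨b', h₁, h₂, h₃⟩ := (isWitness_diskElt.map g).exists_lift hf' b hb
    obtain ⟨y', k₁, k₂, k₃⟩ := (isWitness_diskBoundary.map g).exists_lift hf'
      ((X.page n).d i _ b) (by
        rw [← HomologicalComplex.d_f_apply, hb, HomologicalComplex.d_f_apply, d_diskElt])
    refine ⟨⟨{ l := diskDesc h₁ k₁ (by rw [h₂, k₂])
               fac_left := initialIsInitial.hom_ext _ _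
               fac_right := ?_ }⟩⟩
    refine disk_hom_ext (fun m hm => ?_) (fun m hm => ?_)
    · rw [hom_comp_apply, diskDesc_elt _ _ _ hm, h₃ m hm]
    · rw [hom_comp_apply, diskDesc_boundary _ _ _ hm, k₃ m hm]

/-- Common core of the two sphere-to-disk cases: the witness of the boundary is prescribed upstairs,
and only the chain remains to be lifted. -/
lemma exists_disk_lift {n : ℕ} {i : ℤ × ℤ}
    (hf : ∀ m < n, ∀ i, Function.Surjective ((Hom.hom f m).f i))
    (hn : HomologicalComplex.LiftsBoundaries (Hom.hom f n))
    {a : ∀ m, (X.page m).X (nextBidegree n i)} (ha : X.IsWitness n _ a)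
    (hd : ∀ j, (X.page n).d _ j (a n) = 0) (g : disk R n i ⟶ Y)
    (hg : ∀ m ≤ n, (Hom.hom f m).f _ (a m) = (Hom.hom g m).f _ (diskBoundary R n i m)) :
    ∃ l : disk R n i ⟶ X, l ≫ f = g ∧
      ∀ m ≤ n, (Hom.hom l m).f _ (diskBoundary R n i m) = a m := by
  obtain ⟨b, hb, hb'⟩ := hn i _ (rel_nextBidegree n i) (a n)
    ((Hom.hom g n).f i (diskElt R n i n)) hd (by
      rw [hg n le_rfl, HomologicalComplex.d_f_apply, d_diskElt])
  obtain ⟨b', h₁, h₂, h₃⟩ := (isWitness_diskElt.map g).exists_lift hf b hb'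
  refine ⟨diskDesc h₁ ha (by rw [h₂, hb]), ?_, fun m hm => diskDesc_boundary _ _ _ hm⟩
  refine disk_hom_ext (fun m hm => ?_) (fun m hm => ?_)
  · rw [hom_comp_apply, diskDesc_elt _ _ _ hm, h₃ m hm]
  · rw [hom_comp_apply, diskDesc_boundary _ _ _ hm, hg m hm]

lemma hasLiftingProperty_sphereToDisk {n : ℕ} (i : ℤ × ℤ)
    (hf : ∀ m < n, ∀ i, Function.Surjective ((Hom.hom f m).f i))
    (hn : HomologicalComplex.LiftsBoundaries (Hom.hom f n)) :
    HasLiftingProperty (sphereToDisk R n i) f where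
  sq_hasLift {t g} sq := by
    obtain ⟨l, hl, hl'⟩ := exists_disk_lift hf hn (isWitness_sphereElt.map t)
      (fun j => by rw [HomologicalComplex.d_f_apply, d_sphereElt, map_zero]) g
      (fun m hm => by
        rw [← hom_comp_apply, sq.w, hom_comp_apply, sphereToDisk_elt _ _ hm])
    refine ⟨⟨{ l := l, fac_left := ?_, fac_right := hl }⟩⟩
    refine sphere_hom_ext fun m hm => ?_
    rw [hom_comp_apply, sphereToDisk_elt _ _ hm, hl' m hm]

lemma hasLiftingProperty_sphereSuccToDisk {n : ℕ} (i : ℤ × ℤ)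
    (hf : ∀ m < n, ∀ i, Function.Surjective ((Hom.hom f m).f i))
    (hn : HomologicalComplex.LiftsBoundaries (Hom.hom f n))
    (hn' : ∀ i, Function.Injective ((Hom.hom f (n + 1)).f i)) :
    HasLiftingProperty (sphereSuccToDisk R n i) f where
  sq_hasLift {t g} sq := by
    have hw := isWitness_sphereElt.map t
    obtain ⟨l, hl, hl'⟩ := exists_disk_lift hf hn (fun m hm => hw m (hm.trans n.lt_succ_self))
      (hw n n.lt_succ_self).d_eq_zero g
      (fun m hm => by
        rw [← hom_comp_apply, sq.w, hom_comp_apply, sphereSuccToDisk_elt _ _ (hm.trans n.le_succ)])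
    refine ⟨⟨{ l := l, fac_left := ?_, fac_right := hl }⟩⟩
    refine sphere_hom_ext fun m hm => ?_
    rw [hom_comp_apply, sphereSuccToDisk_elt _ _ hm]
    obtain hm | rfl := hm.lt_or_eq
    · exact hl' m (Nat.le_of_lt_succ hm)
    -- The disk vanishes on page `n + 1`, so `f` kills the image of the sphere generator.
    · apply hn'
      rw [← hom_comp_apply t, sq.w, hom_comp_apply, sphereSuccToDisk_elt _ _ le_rfl,
        diskBoundary_eq_zero n.lt_succ_self]
      simp

lemma liftsBoundaries_of_hasLiftingProperty {n : ℕ}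
    [∀ i, HasLiftingProperty (sphereToDisk R n i) f] :
    HomologicalComplex.LiftsBoundaries (Hom.hom f n) := by
  intro i j hij a b ha h
  obtain rfl : nextBidegree n i = j := hij
  obtain ⟨a', h₁, rfl⟩ := exists_isWitness a
  obtain ⟨b', h₂, rfl⟩ := exists_isWitness b
  -- The boundary witness in `Y` is taken to be the image of that of `a`, so the square commutes on
  -- lower pages too.
  have sq : CommSq (sphereDesc h₁ ha) (sphereToDisk R n i) f
      (diskDesc h₂ (h₁.map f) h.symm) := ⟨sphere_hom_ext fun m hm => by
    rw [hom_comp_apply, hom_comp_apply, sphereDesc_elt _ _ hm, sphereToDisk_elt _ _ hm,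
      diskDesc_boundary _ _ _ hm]⟩
  refine ⟨(Hom.hom sq.lift n).f i (diskElt R n i n), ?_, ?_⟩
  · rw [HomologicalComplex.d_f_apply, d_diskElt, ← sphereToDisk_elt n i le_rfl, ← hom_comp_apply,
      sq.fac_left, sphereDesc_elt _ _ le_rfl]
  · rw [← hom_comp_apply, sq.fac_right, diskDesc_elt _ _ _ le_rfl]

/-- As `f x = 0`, the image of a representative of the characteristic class of `x` bounds on page
`n`. This gives a square whose lift makes `x` factor through page `n + 1` of `disk R n i`, which is
zero. -/
lemma eq_zero_of_hasLiftingProperty {n : ℕ} [∀ i, HasLiftingProperty (sphereSuccToDisk R n i) f]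
    {j : ℤ × ℤ} (x : (X.page (n + 1)).X j) (hd : ∀ k, (X.page (n + 1)).d j k x = 0)
    (hx : (Hom.hom f (n + 1)).f j x = 0) : x = 0 := by
  obtain ⟨i, rfl⟩ := exists_nextBidegree n j
  obtain ⟨a, ha, rfl⟩ := exists_isWitness x
  have hfa := ha.map f
  have hfa' : Y.IsWitness n _ (fun m => (Hom.hom f m).f _ (a m)) :=
    fun m hm => hfa m (hm.trans n.lt_succ_self)
  have H := hfa n n.lt_succ_self
  dsimp only at H
  rw [hx, map_zero] at H
  obtain ⟨b, hb⟩ := H.exists_boundary (ComplexShape.prev_eq' _ (rel_nextBidegree n i))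
  obtain ⟨b', h₂, rfl⟩ := exists_isWitness b
  have sq : CommSq (sphereDesc ha hd) (sphereSuccToDisk R n i) f
      (diskDesc h₂ hfa' hb) :=
    ⟨sphere_hom_ext fun m hm => by
      rw [hom_comp_apply, hom_comp_apply, sphereDesc_elt _ _ hm, sphereSuccToDisk_elt _ _ hm]
      obtain hm | rfl := hm.lt_or_eq
      · exact (diskDesc_boundary h₂ hfa' hb (Nat.le_of_lt_succ hm)).symm
      · rw [hx, diskBoundary_eq_zero n.lt_succ_self, map_zero]⟩
  rw [← sphereDesc_elt ha hd le_rfl, ← sq.fac_left, hom_comp_apply,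
    sphereSuccToDisk_elt _ _ le_rfl, diskBoundary_eq_zero n.lt_succ_self, map_zero]

/-- If `f x = 0`, then `d x` is a cycle killed by `f`, hence zero; so `x` is a cycle too, and the
same argument applies to it. -/
lemma injective_of_hasLiftingProperty {n : ℕ}
    [∀ i, HasLiftingProperty (sphereSuccToDisk R n i) f] (i : ℤ × ℤ) :
    Function.Injective ((Hom.hom f (n + 1)).f i) := by
  rw [injective_iff_map_eq_zero]
  intro x hx
  refine eq_zero_of_hasLiftingProperty x (fun k => ?_) hx
  refine eq_zero_of_hasLiftingProperty (f := f) _ (fun l => ?_) ?_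
  · rw [← ModuleCat.comp_apply, HomologicalComplex.d_comp_d]; rfl
  · rw [← HomologicalComplex.d_f_apply, hx, map_zero]

variable (R) in
/-- The generating trivial cofibrations. -/
inductive generatingTrivialCofibrations (r : ℕ) : MorphismProperty (ExtendedSpectralSequence R)
  | initial_to_disk (n : ℕ) (hn : n ≤ r) (i : ℤ × ℤ) :
      generatingTrivialCofibrations r (initial.to (disk R n i))

variable (R) in
/-- The generating cofibrations. -/
inductive generatingCofibrations (r : ℕ) : MorphismProperty (ExtendedSpectralSequence R)
  | initial_to_disk (n : ℕ) (i : ℤ × ℤ) : generatingCofibrations r (initial.to (disk R n i))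
  | sphere_to_disk (i : ℤ × ℤ) : generatingCofibrations r (sphereToDisk R r i)
  | sphere_succ_to_disk (n : ℕ) (hn : r ≤ n) (i : ℤ × ℤ) :
      generatingCofibrations r (sphereSuccToDisk R n i)

lemma rlp_generatingTrivialCofibrations (r : ℕ) :
    (generatingTrivialCofibrations R r).rlp = surjectiveUpTo R r := by
  ext X Y f
  constructor
  · intro h n hn i
    have := h _ (.initial_to_disk n hn i)
    exact surjective_of_hasLiftingProperty
  · rintro h _ _ _ ⟨n, hn, i⟩
    exact hasLiftingProperty_initial_to_disk i fun m hm => h m (hm.trans hn)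

lemma rlp_generatingCofibrations (r : ℕ) :
    (generatingCofibrations R r).rlp = surjectiveUpTo R r ⊓ quasiIsoIsoAbove R r := by
  ext X Y f
  constructor
  · intro h
    have hs (n : ℕ) (i : ℤ × ℤ) : Function.Surjective ((Hom.hom f n).f i) := by
      have := h _ (.initial_to_disk n i)
      exact surjective_of_hasLiftingProperty
    refine ⟨fun n _ => hs n, ?_, fun s hrs => ?_⟩
    · have (i : ℤ × ℤ) := h _ (.sphere_to_disk i)
      exact HomologicalComplex.quasiIso_of_liftsBoundaries (rel_prev r) (rel_next r)
        (liftsBoundaries_of_hasLiftingProperty (f := f))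
    · obtain ⟨n, rfl⟩ := Nat.exists_eq_add_of_lt hrs
      have (i : ℤ × ℤ) := h _ (.sphere_succ_to_disk (r + n) (Nat.le_add_right _ _) i)
      exact (HomologicalComplex.isIso_iff_bijective _).2 fun i =>
        ⟨injective_of_hasLiftingProperty i, hs _ i⟩
  · rintro ⟨h, hq, hi⟩
    have hs (n : ℕ) (i : ℤ × ℤ) : Function.Surjective ((Hom.hom f n).f i) := by
      obtain hn | hn := le_or_gt n r
      · exact h n hn i
      · have := hi n hn
        exact ((HomologicalComplex.isIso_iff_bijective _).1 this i).2
    have hb (n : ℕ) (hn : r ≤ n) : HomologicalComplex.LiftsBoundaries (Hom.hom f n) := by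
      obtain hn | rfl := hn.lt_or_eq
      · have := hi n hn
        exact HomologicalComplex.liftsBoundaries_of_isIso _
      · exact HomologicalComplex.liftsBoundaries_of_quasiIso (hs r)
    rintro _ _ _ (⟨n, i⟩ | ⟨i⟩ | ⟨n, hn, i⟩)
    · exact hasLiftingProperty_initial_to_disk i fun m _ => hs m
    · exact hasLiftingProperty_sphereToDisk i (fun m _ => hs m) (hb r le_rfl)
    · refine hasLiftingProperty_sphereSuccToDisk i (fun m _ => hs m) (hb n hn) fun i => ?_
      have := hi (n + 1) (Nat.lt_succ_of_le hn)
      exact ((HomologicalComplex.isIso_iff_bijective _).1 this i).1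

instance (r : ℕ) : MorphismProperty.IsSmall.{u} (generatingTrivialCofibrations R r) where
  small_toSet := by
    let φ (a : {n // n ≤ r} × (ℤ × ℤ)) : (generatingTrivialCofibrations R r).toSet :=
      ⟨Arrow.mk (initial.to (disk R a.1.1 a.2)), .initial_to_disk a.1.1 a.1.2 a.2⟩
    refine small_of_surjective (f := φ) ?_
    rintro ⟨⟨_, _, _⟩, ⟨n, hn, i⟩⟩
    exact ⟨⟨⟨n, hn⟩, i⟩, rfl⟩

instance (r : ℕ) : MorphismProperty.IsSmall.{u} (generatingCofibrations R r) where
  small_toSet := by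
    let φ : (ℕ × (ℤ × ℤ)) ⊕ (ℤ × ℤ) ⊕ ({n // r ≤ n} × (ℤ × ℤ)) →
        (generatingCofibrations R r).toSet
      | .inl a => ⟨Arrow.mk (initial.to (disk R a.1 a.2)), .initial_to_disk a.1 a.2⟩
      | .inr (.inl i) => ⟨Arrow.mk (sphereToDisk R r i), .sphere_to_disk i⟩
      | .inr (.inr a) =>
        ⟨Arrow.mk (sphereSuccToDisk R a.1.1 a.2), .sphere_succ_to_disk a.1.1 a.1.2 a.2⟩
    refine small_of_surjective (f := φ) ?_
    rintro ⟨⟨_, _, _⟩, (⟨n, i⟩ | ⟨i⟩ | ⟨n, hn, i⟩)⟩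
    · exact ⟨.inl ⟨n, i⟩, rfl⟩
    · exact ⟨.inr (.inl i), rfl⟩
    · exact ⟨.inr (.inr ⟨⟨n, hn⟩, i⟩), rfl⟩

end ExtendedSpectralSequence

/-! ### Limits via the special adjoint functor theorem -/

namespace ExtendedSpectralSequence

variable {R : Type u} [CommRing R]

section Limits

variable {X Y Z : ExtendedSpectralSequence R} (q : X ⟶ Y)
  (hq : ∀ k i, Function.Surjective ((Hom.hom q k).f i)) (f : X ⟶ Z)
  (hf : ∀ k i x, (Hom.hom q k).f i x = 0 → (Hom.hom f k).f i x = 0)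

include hq hf in
-- In each bidegree `q` is the quotient by its kernel; compatibility with differentials and
-- characteristic maps is checked after cancelling the epimorphism `q`.
lemma exists_desc_of_surjective : ∃ g : Y ⟶ Z, q ≫ g = f := by
  have key (k : ℕ) (i : ℤ × ℤ) : ∃ g : (Y.page k).X i ⟶ (Z.page k).X i,
      (Hom.hom q k).f i ≫ g = (Hom.hom f k).f i := by
    let e := ((Hom.hom q k).f i).hom.quotKerEquivOfSurjective (hq k i)
    refine ⟨ModuleCat.ofHom ((Submodule.liftQ _ ((Hom.hom f k).f i).hom (hf k i)).comp
      e.symm.toLinearMap), ?_⟩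
    ext x
    have : e.symm ((Hom.hom q k).f i x) = Submodule.Quotient.mk x := by
      rw [LinearEquiv.symm_apply_eq]
      rfl
    change Submodule.liftQ _ _ (hf k i) (e.symm ((Hom.hom q k).f i x)) = _
    rw [this]
    rfl
  choose g hg using key
  have hepi (k : ℕ) (i : ℤ × ℤ) : Epi ((Hom.hom q k).f i) :=
    (ModuleCat.epi_iff_surjective _).2 (hq k i)
  let g' (k : ℕ) : Y.page k ⟶ Z.page k :=
    { f := g k
      comm' := fun i j _ => by
        rw [← cancel_epi ((Hom.hom q k).f i), ← Category.assoc, hg, HomologicalComplex.Hom.comm,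
          HomologicalComplex.Hom.comm_assoc, hg] }
  have hg' (k : ℕ) : Hom.hom q k ≫ g' k = Hom.hom f k := by
    ext1 i
    exact hg k i
  refine ⟨Hom.mk g' fun k i => ?_, hom_ext hg'⟩
  rw [← cancel_epi ((Hom.hom q (k + 1)).f i), ← Category.assoc, ← Hom.comm, Category.assoc,
    ← HomologicalComplex.homologyMap_comp, hg', Hom.comm, ← hg', HomologicalComplex.comp_f,
    Category.assoc]

end Limits

/-- The elements of all pages that are killed by a morphism. -/
def kernel {X Y : ExtendedSpectralSequence R} (q : X ⟶ Y) :
    ∀ (k : ℕ) (i : ℤ × ℤ), Set ((X.page k).X i) :=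
  fun k i => {x | (Hom.hom q k).f i x = 0}

/-- Subobjects in the opposite category are quotients; epimorphisms are surjective on all pages, so
a quotient is determined by its kernel. -/
instance : WellPowered.{u} (ExtendedSpectralSequence R)ᵒᵖ where
  subobject_small X := by
    refine small_of_injective (β := ∀ (k : ℕ) (i : ℤ × ℤ), Set ((X.unop.page k).X i))
      (f := fun S => kernel S.arrow.unop) ?_
    have key (S T : Subobject X) (h : kernel S.arrow.unop = kernel T.arrow.unop) : S ≤ T := by
      obtain ⟨g, hg⟩ := exists_desc_of_surjective T.arrow.unop
        (fun k i => surjective_of_epi _ k i) S.arrow.unop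
        (fun k i x hx => by
          have : x ∈ kernel T.arrow.unop k i := hx
          rwa [← h] at this)
      exact Subobject.le_of_comm g.op (Quiver.Hom.unop_inj (by simpa using hg))
    intro S T h
    exact le_antisymm (key S T h) (key T S h.symm)

variable (R) in
/-- The disks, as a family of objects. -/
def disks : ObjectProperty (ExtendedSpectralSequence R) :=
  ObjectProperty.ofObj fun a : ℕ × (ℤ × ℤ) => disk R a.1 a.2

lemma isSeparating_disks : (disks R).IsSeparating := by
  intro X Y f g h
  ext k i x
  obtain ⟨t, rfl⟩ := exists_disk_hom x
  change (Hom.hom f k).f i _ = (Hom.hom g k).f i _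
  rw [← hom_comp_apply, ← hom_comp_apply, h _ ⟨(k, i)⟩ t]

instance : HasLimits (ExtendedSpectralSequence R) :=
  have : ObjectProperty.Small.{u} (disks R) := by
    unfold disks
    infer_instance
  hasLimits_of_hasColimits_of_isSeparating isSeparating_disks

end ExtendedSpectralSequence

/-! ### Smallness of spheres -/

namespace ExtendedSpectralSequence

variable {R : Type u} [CommRing R]

section Filtered

variable {J : Type u} [LinearOrder J] {F : J ⥤ ExtendedSpectralSequence R}
  {t : Cocone F} (ht : IsColimit t)

lemma ι_map_apply (t : Cocone F) {j k : J} (f : j ⟶ k) (m : ℕ) (i : ℤ × ℤ)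
    (x : ((F.obj j).page m).X i) :
    (Hom.hom (t.ι.app k) m).f i ((Hom.hom (F.map f) m).f i x) =
      (Hom.hom (t.ι.app j) m).f i x := by
  rw [← hom_comp_apply, t.w]

lemma map_map_apply {j k l : J} (f : j ⟶ k) (g : k ⟶ l) (h : j ⟶ l) (m : ℕ) (i : ℤ × ℤ)
    (x : ((F.obj j).page m).X i) :
    (Hom.hom (F.map g) m).f i ((Hom.hom (F.map f) m).f i x) =
      (Hom.hom (F.map h) m).f i x := by
  rw [← hom_comp_apply, ← F.map_comp]
  rfl

variable [Nonempty J]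

include ht

lemma exists_rep_of_isColimit {m : ℕ} {i : ℤ × ℤ} (x : (t.pt.page m).X i) :
    ∃ (j : J) (y : ((F.obj j).page m).X i), (Hom.hom (t.ι.app j) m).f i y = x :=
  Concrete.isColimit_exists_rep (F ⋙ evalFunctor R m i)
    (isColimitOfPreserves (evalFunctor R m i) ht) x

lemma exists_map_eq_of_isColimit {m : ℕ} {i : ℤ × ℤ} {j : J} (x y : ((F.obj j).page m).X i)
    (h : (Hom.hom (t.ι.app j) m).f i x = (Hom.hom (t.ι.app j) m).f i y) :
    ∃ (k : J) (f : j ⟶ k), (Hom.hom (F.map f) m).f i x = (Hom.hom (F.map f) m).f i y := by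
  obtain ⟨k, f, g, hfg⟩ := Concrete.isColimit_exists_of_rep_eq (F ⋙ evalFunctor R m i)
    (isColimitOfPreserves (evalFunctor R m i) ht) x y h
  obtain rfl : f = g := Subsingleton.elim _ _
  exact ⟨k, f, hfg⟩

lemma exists_map_eq_of_isColimit' {i : ℤ × ℤ} {j : J} (x y : ∀ m, ((F.obj j).page m).X i) (n : ℕ)
    (h : ∀ m < n, (Hom.hom (t.ι.app j) m).f i (x m) = (Hom.hom (t.ι.app j) m).f i (y m)) :
    ∃ (k : J) (f : j ⟶ k),
      ∀ m < n, (Hom.hom (F.map f) m).f i (x m) = (Hom.hom (F.map f) m).f i (y m) := by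
  induction n with
  | zero => exact ⟨j, 𝟙 j, fun m hm => (Nat.not_lt_zero m hm).elim⟩
  | succ n ih =>
    obtain ⟨k, f, hf⟩ := ih fun m hm => h m (hm.trans n.lt_succ_self)
    obtain ⟨k', f', hf'⟩ := exists_map_eq_of_isColimit ht (x n) (y n) (h n n.lt_succ_self)
    refine ⟨max k k', homOfLE (f.le.trans (le_max_left _ _)), fun m hm => ?_⟩
    obtain hm | rfl := (Nat.le_of_lt_succ hm).lt_or_eq
    · rw [← map_map_apply f (homOfLE (le_max_left k k')), hf m hm, map_map_apply]
    · rw [← map_map_apply f' (homOfLE (le_max_right k k')), hf', map_map_apply]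

lemma exists_cycle_of_isColimit {m : ℕ} {i : ℤ × ℤ} (x : (t.pt.page m).X i)
    (hx : ∀ j, (t.pt.page m).d i j x = 0) :
    ∃ (j : J) (y : ((F.obj j).page m).X i), (Hom.hom (t.ι.app j) m).f i y = x ∧
      ∀ k, ((F.obj j).page m).d i k y = 0 := by
  obtain ⟨j, y, rfl⟩ := exists_rep_of_isColimit ht x
  obtain ⟨k, f, hf⟩ := exists_map_eq_of_isColimit ht
    (((F.obj j).page m).d i (nextBidegree m i) y) 0
    ((HomologicalComplex.d_f_apply _ _ _ _).symm.trans ((hx _).trans (map_zero _).symm))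
  refine ⟨k, (Hom.hom (F.map f) m).f i y, ι_map_apply _ _ _ _ _, fun l => ?_⟩
  by_cases hl : (bigradedShape m).Rel i l
  · obtain rfl : nextBidegree m i = l := hl
    rw [HomologicalComplex.d_f_apply, hf, map_zero]
  · rw [HomologicalComplex.shape _ _ _ hl]
    rfl

/-- Representing means differing from some representative `c` by a boundary; the bounding chain and
the equation both appear at a later stage. -/
lemma exists_represents_of_isColimit {m : ℕ} {i : ℤ × ℤ} {j : J} (y : ((F.obj j).page m).X i)
    (x : ((F.obj j).page (m + 1)).X i)
    (h : (t.pt.page m).Represents i ((Hom.hom (t.ι.app j) m).f i y)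
      (t.pt.char m i ((Hom.hom (t.ι.app j) (m + 1)).f i x))) :
    ∃ (k : J) (f : j ⟶ k), ((F.obj k).page m).Represents i ((Hom.hom (F.map f) m).f i y)
      ((F.obj k).char m i ((Hom.hom (F.map f) (m + 1)).f i x)) := by
  obtain ⟨c, hc⟩ := HomologicalComplex.exists_represents ((F.obj j).char m i x)
  rw [char_map_apply] at h
  have H := (hc.map (Hom.hom (t.ι.app j) m)).sub h
  rw [sub_self] at H
  obtain ⟨b, hb⟩ := H.exists_boundary rfl
  obtain ⟨j', b, rfl⟩ := exists_rep_of_isColimit ht b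
  let p : j ⟶ max j j' := homOfLE (le_max_left _ _)
  let p' : j' ⟶ max j j' := homOfLE (le_max_right _ _)
  obtain ⟨k, f, hf⟩ := exists_map_eq_of_isColimit ht
    (((F.obj (max j j')).page m).d _ i ((Hom.hom (F.map p') m).f _ b))
    ((Hom.hom (F.map p) m).f i (c - y)) (by
      refine (HomologicalComplex.d_f_apply _ _ _ _).symm.trans ?_
      rw [ι_map_apply, ι_map_apply, map_sub]
      exact hb)
  refine ⟨k, p ≫ f, ?_⟩
  rw [map_map_apply p f (p ≫ f), ← HomologicalComplex.d_f_apply, map_sub] at hf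
  rw [char_map_apply]
  have H' := (hc.map (Hom.hom (F.map (p ≫ f)) m)).sub_boundary
    ((Hom.hom (F.map f) m).f _ ((Hom.hom (F.map p') m).f _ b))
  rwa [hf, sub_sub_cancel] at H'

lemma exists_sphere_rep_of_isColimit {i : ℤ × ℤ} (n : ℕ) (x : ∀ m, (t.pt.page m).X i)
    (hx : t.pt.IsWitness n i x) (hd : ∀ k, (t.pt.page n).d i k (x n) = 0) :
    ∃ (j : J) (y : ∀ m, ((F.obj j).page m).X i), (F.obj j).IsWitness n i y ∧
      (∀ k, ((F.obj j).page n).d i k (y n) = 0) ∧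
      ∀ m ≤ n, (Hom.hom (t.ι.app j) m).f i (y m) = x m := by
  induction n with
  | zero =>
    obtain ⟨j, y, hy, hy'⟩ := exists_cycle_of_isColimit ht (x 0) hd
    refine ⟨j, Function.update (fun _ => 0) 0 y, fun m hm => (Nat.not_lt_zero m hm).elim,
      by simpa using hy', fun m hm => ?_⟩
    obtain rfl := Nat.le_zero.1 hm
    simpa using hy
  | succ n ih =>
    obtain ⟨j, y, h₁, h₂, h₃⟩ := ih (fun m hm => hx m (hm.trans n.lt_succ_self))
      (hx n n.lt_succ_self).d_eq_zero
    obtain ⟨j', z, hz, hz'⟩ := exists_cycle_of_isColimit ht (x (n + 1)) hd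
    let p : j ⟶ max j j' := homOfLE (le_max_left _ _)
    let p' : j' ⟶ max j j' := homOfLE (le_max_right _ _)
    obtain ⟨k, f, hf⟩ := exists_represents_of_isColimit ht (m := n)
      ((Hom.hom (F.map p) n).f i (y n))
      ((Hom.hom (F.map p') (n + 1)).f i z) (by
        rw [ι_map_apply, ι_map_apply, hz, h₃ n le_rfl]
        exact hx n n.lt_succ_self)
    rw [map_map_apply p f (p ≫ f), map_map_apply p' f (p' ≫ f)] at hf
    let y' (m : ℕ) : ((F.obj k).page m).X i := (Hom.hom (F.map (p ≫ f)) m).f i (y m)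
    let z' : ((F.obj k).page (n + 1)).X i := (Hom.hom (F.map (p' ≫ f)) (n + 1)).f i z
    have hu (m : ℕ) (hm : m ≤ n) : Function.update y' (n + 1) z' m = y' m :=
      Function.update_of_ne (by omega) _ _
    refine ⟨k, Function.update y' (n + 1) z', fun m hm => ?_, fun l => ?_, fun m hm => ?_⟩
    · obtain hm | rfl := (Nat.le_of_lt_succ hm).lt_or_eq
      · rw [hu m hm.le, hu (m + 1) hm]
        exact h₁.map (F.map (p ≫ f)) m hm
      · rw [hu m le_rfl, Function.update_self]
        exact hf
    · rw [Function.update_self, HomologicalComplex.d_f_apply, hz', map_zero]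
    · obtain hm | rfl := hm.lt_or_eq
      · rw [hu m (Nat.le_of_lt_succ hm)]
        exact (ι_map_apply t (p ≫ f) _ _ _).trans (h₃ m (Nat.le_of_lt_succ hm))
      · rw [Function.update_self]
        exact (ι_map_apply t (p' ≫ f) _ _ _).trans hz

omit ht

variable (F)

/-- A morphism from a sphere is a finite list of elements subject to finitely many relations, so it
descends to some stage, and two that agree in the colimit agree at some stage. -/
instance preservesColimit_coyoneda_sphere (n : ℕ) (i : ℤ × ℤ) :
    PreservesColimit F (coyoneda.obj (Opposite.op (sphere R n i))) where
  preserves {t} ht := by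
    refine ⟨Types.FilteredColimit.isColimitOf' _ _ (fun h => ?_) (fun j g g' h => ?_)⟩
    · change sphere R n i ⟶ t.pt at h
      obtain ⟨j, y, h₁, h₂, h₃⟩ := exists_sphere_rep_of_isColimit ht n _
        (isWitness_sphereElt.map h)
        (fun l => by rw [HomologicalComplex.d_f_apply, d_sphereElt, map_zero])
      refine ⟨j, sphereDesc h₁ h₂, ?_⟩
      change h = sphereDesc h₁ h₂ ≫ t.ι.app j
      refine sphere_hom_ext fun m hm => ?_
      rw [hom_comp_apply, sphereDesc_elt _ _ hm, h₃ m hm]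
    · change sphere R n i ⟶ F.obj j at g g'
      change g ≫ t.ι.app j = g' ≫ t.ι.app j at h
      obtain ⟨k, f, hf⟩ := exists_map_eq_of_isColimit' ht
        (fun m => (Hom.hom g m).f i (sphereElt R n i m))
        (fun m => (Hom.hom g' m).f i (sphereElt R n i m)) (n + 1) (fun m _ => by
          rw [← hom_comp_apply, h, hom_comp_apply])
      refine ⟨k, f, ?_⟩
      change g ≫ F.map f = g' ≫ F.map f
      exact sphere_hom_ext fun m hm => hf m (Nat.lt_succ_of_le hm)

instance preservesColimit_coyoneda_initial :
    PreservesColimit F (coyoneda.obj (Opposite.op (⊥_ ExtendedSpectralSequence R))) where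
  preserves {t} _ := by
    refine ⟨Types.FilteredColimit.isColimitOf' _ _ (fun h => ?_) (fun j g g' h => ?_)⟩
    · exact ⟨Classical.arbitrary J, initial.to _, initialIsInitial.hom_ext _ _⟩
    · exact ⟨j, 𝟙 j, initialIsInitial.hom_ext _ _⟩

end Filtered

attribute [local instance] Cardinal.fact_isRegular_aleph0

/-- Only sources of generators must be small, and these are spheres or the initial object; sequences
indexed by `ℵ₀` suffice. -/
lemma hasSmallObjectArgument_of_preservesColimit (I : MorphismProperty (ExtendedSpectralSequence R))
    [MorphismProperty.IsSmall.{u} I]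
    (h : ∀ (J : Type u) [LinearOrder J] [Nonempty J] (F : J ⥤ ExtendedSpectralSequence R)
      {A B : ExtendedSpectralSequence R} (i : A ⟶ B), I i →
        PreservesColimit F (coyoneda.obj (Opposite.op A))) :
    MorphismProperty.HasSmallObjectArgument.{u} I where
  exists_cardinal := by
    let _ : OrderBot Cardinal.aleph0.{u}.ord.ToType := Cardinal.orderBotAleph0OrdToType
    exact ⟨Cardinal.aleph0, inferInstance, inferInstance,
      { preservesColimit := fun i hi _ hf => h _ hf.F i hi }⟩

instance (r : ℕ) : MorphismProperty.HasSmallObjectArgument.{u} (generatingCofibrations R r) :=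
  hasSmallObjectArgument_of_preservesColimit _ fun J _ _ F _ _ _ hi => by
    cases hi <;> infer_instance

instance (r : ℕ) :
    MorphismProperty.HasSmallObjectArgument.{u} (generatingTrivialCofibrations R r) :=
  hasSmallObjectArgument_of_preservesColimit _ fun J _ _ F _ _ _ hi => by
    cases hi; infer_instance

end ExtendedSpectralSequence

/-! ### Adding a contractible complex to make a morphism surjective -/

namespace HomologicalComplex

variable {R : Type u} [CommRing R] {ι : Type*} {c : ComplexShape ι}
  {K L : HomologicalComplex (ModuleCat.{u} R) c}

lemma d_d_apply (K : HomologicalComplex (ModuleCat.{u} R) c) (i j k : ι) (x : K.X i) :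
    K.d j k (K.d i j x) = 0 := by
  rw [← ModuleCat.comp_apply, d_comp_d]
  rfl

variable (K L) in
open Classical in
/-- The differentials of the direct sum of `K` and a contractible complex that surjects
onto `L`. -/
noncomputable def sumPathD (i j : ι) :
    (K.X i × L.X i × L.X (c.prev i)) →ₗ[R] (K.X j × L.X j × L.X (c.prev j)) :=
  LinearMap.prod ((K.d i j).hom ∘ₗ LinearMap.fst _ _ _)
    (LinearMap.prod 0
      (if h : c.Rel i j then
        -- The formula is `d (x, y, z) = (d x, 0, y)`, with `y` transported along `c.prev j = i`.
        (L.XIsoOfEq (c.prev_eq' h).symm).hom.hom ∘ₗ LinearMap.fst _ _ _ ∘ₗ LinearMap.snd _ _ _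
      else 0))

lemma sumPathD_apply {i j : ι} (h : c.Rel i j) (x : K.X i × L.X i × L.X (c.prev i)) :
    sumPathD K L i j x = (K.d i j x.1, 0, (L.XIsoOfEq (c.prev_eq' h).symm).hom x.2.1) := by
  simp [sumPathD, h]

lemma sumPathD_of_not_rel {i j : ι} (h : ¬ c.Rel i j) : sumPathD K L i j = 0 := by
  ext <;> simp [sumPathD, h]

variable (K L) in
/-- The direct sum of `K` and a contractible complex that surjects onto `L`. -/
noncomputable def sumPath : HomologicalComplex (ModuleCat.{u} R) c where
  X i := ModuleCat.of R (K.X i × L.X i × L.X (c.prev i))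
  d i j := ModuleCat.ofHom (sumPathD K L i j)
  shape i j h := by rw [sumPathD_of_not_rel h]; rfl
  d_comp_d' i j k hij hjk := by
    apply ModuleCat.hom_ext
    refine LinearMap.ext fun x => ?_
    change sumPathD K L j k (sumPathD K L i j x) = 0
    rw [sumPathD_apply hij, sumPathD_apply hjk, d_d_apply, map_zero]
    rfl

lemma sumPath_d_apply {i j : ι} (h : c.Rel i j) (x : K.X i) (y : L.X i) (z : L.X (c.prev i)) :
    (sumPath K L).d i j (x, y, z) =
      (K.d i j x, (0 : L.X j), (L.XIsoOfEq (c.prev_eq' h).symm).hom y) :=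
  sumPathD_apply h (x, y, z)

/-- The inclusion of the first summand of `sumPath K L`. -/
noncomputable def sumPathInl (K L : HomologicalComplex (ModuleCat.{u} R) c) : K ⟶ sumPath K L where
  f i := ModuleCat.ofHom (LinearMap.inl R (K.X i) (L.X i × L.X (c.prev i)))
  comm' i j h := by
    apply ModuleCat.hom_ext
    refine LinearMap.ext fun x => ?_
    refine (sumPath_d_apply h x 0 0).trans ?_
    rw [map_zero]
    rfl

/-- The projection of `sumPath K L` to its first summand. -/
noncomputable def sumPathFst (K L : HomologicalComplex (ModuleCat.{u} R) c) : sumPath K L ⟶ K where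
  f i := ModuleCat.ofHom (LinearMap.fst R (K.X i) (L.X i × L.X (c.prev i)))
  comm' i j h := by
    apply ModuleCat.hom_ext
    refine LinearMap.ext fun x => ?_
    exact (congrArg Prod.fst (sumPath_d_apply h x.1 x.2.1 x.2.2)).symm

/-- The projection in the factorization of a morphism `f : K ⟶ L` through `sumPath K L`. -/
noncomputable def sumPathDesc (f : K ⟶ L) : sumPath K L ⟶ L where
  f i := ModuleCat.ofHom (LinearMap.coprod (f.f i).hom
    (LinearMap.coprod LinearMap.id (L.d (c.prev i) i).hom))
  comm' i j h := by
    apply ModuleCat.hom_ext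
    refine LinearMap.ext fun x => ?_
    obtain ⟨x, y, z⟩ := x
    have e (y : L.X i) : L.d (c.prev j) j ((L.XIsoOfEq (c.prev_eq' h).symm).hom y) = L.d i j y := by
      rw [← ModuleCat.comp_apply]
      simp
    refine Eq.trans ?_ (congrArg (LinearMap.coprod (f.f j).hom
      (LinearMap.coprod LinearMap.id (L.d (c.prev j) j).hom)) (sumPath_d_apply h x y z)).symm
    change L.d i j (f.f i x + (y + L.d _ i z)) =
      f.f j (K.d i j x) + (0 + L.d (c.prev j) j ((L.XIsoOfEq (c.prev_eq' h).symm).hom y))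
    rw [e, map_add, map_add, d_d_apply, d_f_apply, add_zero, zero_add]

lemma sumPathInl_fst (K L : HomologicalComplex (ModuleCat.{u} R) c) :
    sumPathInl K L ≫ sumPathFst K L = 𝟙 K := rfl

lemma sumPathInl_desc (f : K ⟶ L) : sumPathInl K L ≫ sumPathDesc f = f := by
  ext i x
  change f.f i x + ((0 : L.X i) + L.d _ i 0) = f.f i x
  rw [map_zero, add_zero, add_zero]

lemma surjective_sumPathDesc (f : K ⟶ L) (i : ι) : Function.Surjective ((sumPathDesc f).f i) := by
  intro y
  refine ⟨((0 : K.X i), y, (0 : L.X (c.prev i))), ?_⟩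
  change f.f i 0 + (y + L.d _ i 0) = y
  rw [map_zero, map_zero, add_zero, zero_add]

/-- The retraction `sumPathFst` lifts boundaries: a cycle `(d b, y, z)` has `y = 0`, so it equals `d
(b, z, 0)`. Two-out-of-three does the rest. -/
lemma quasiIso_sumPathInl (hc : ∀ i, c.Rel (c.prev i) i) (hc' : ∀ i, c.Rel i (c.next i)) :
    QuasiIso (sumPathInl K L) := by
  have h : LiftsBoundaries (sumPathFst K L) := by
    rintro i j hij ⟨x, y, z⟩ b ha hab
    obtain rfl : x = K.d i j b := hab
    have hy : (L.XIsoOfEq (c.prev_eq' (hc' j)).symm).hom y = 0 :=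
      congrArg (fun t => t.2.2) ((sumPath_d_apply (hc' j) _ y z).symm.trans (ha _))
    obtain rfl : y = 0 := by
      have := congrArg (L.XIsoOfEq (c.prev_eq' (hc' j)).symm).inv hy
      rw [← ModuleCat.comp_apply, Iso.hom_inv_id, map_zero] at this
      exact this
    refine ⟨(b, (L.XIsoOfEq (c.prev_eq' hij).symm).inv z, (0 : L.X (c.prev i))), ?_, rfl⟩
    rw [sumPath_d_apply hij, ← ModuleCat.comp_apply, Iso.inv_hom_id]
    rfl
  have := quasiIso_of_liftsBoundaries hc hc' h
  have : QuasiIso (sumPathInl K L ≫ sumPathFst K L) := by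
    rw [sumPathInl_fst]
    infer_instance
  exact quasiIso_of_comp_right (sumPathInl K L) (sumPathFst K L)

end HomologicalComplex

/-! ### Factorization into a weak equivalence and a fibration -/

namespace ExtendedSpectralSequence

variable {R : Type u} [CommRing R]

/-- The position of a page relatively to page `r`. -/
inductive Position
  | below
  | equal
  | above

/-- The position of page `k` relatively to page `r`. -/
def position (r k : ℕ) : Position :=
  if k < r then .below else if k = r then .equal else .above

/-- The possible positions of two consecutive pages, the higher one first. -/
inductive Position.Consecutive : Position → Position → Prop
  | below_below : Consecutive .below .below
  | equal_below : Consecutive .equal .below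
  | above_equal : Consecutive .above .equal
  | above_above : Consecutive .above .above

lemma position_of_lt {r k : ℕ} (h : k < r) : position r k = .below := if_pos h

lemma position_self (r : ℕ) : position r r = .equal := by simp [position]

lemma position_of_gt {r k : ℕ} (h : r < k) : position r k = .above := by
  rw [position, if_neg (by omega), if_neg (by omega)]

/-- Pages are defined by cases on the position, so compatibility with characteristic maps is only to
be checked for four pairs. -/
lemma position_consecutive (r k : ℕ) :
    Position.Consecutive (position r (k + 1)) (position r k) := by
  obtain h | rfl | h := lt_trichotomy k r
  · rw [position_of_lt h]
    obtain h | rfl := (Nat.succ_le_of_lt h).lt_or_eq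
    · rw [position_of_lt h]
      constructor
    · rw [position_self]
      constructor
  · rw [position_self, position_of_gt k.lt_succ_self]
    constructor
  · rw [position_of_gt h, position_of_gt (h.trans k.lt_succ_self)]
    constructor

namespace PathFactorization

open HomologicalComplex

variable {A B : ExtendedSpectralSequence R} (f : A ⟶ B)

variable (A B) in
/-- The pages of the factorization. -/
noncomputable def page (k : ℕ) : Position → BigradedComplex R k
  | .below => B.page k
  | .equal => sumPath (A.page k) (B.page k)
  | .above => A.page k

/-- The characteristic maps of the factorization. -/
noncomputable def char (k : ℕ) (i : ℤ × ℤ) :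
    ∀ p q, (page A B (k + 1) p).X i ⟶ (page A B k q).homology i
  | .below, .below => B.char k i
  | .equal, .below => (sumPathDesc (Hom.hom f (k + 1))).f i ≫ B.char k i
  | .above, .equal => A.char k i ≫ homologyMap (sumPathInl (A.page k) (B.page k)) i
  | .above, .above => A.char k i
  -- The remaining pairs never occur for consecutive pages; their value is irrelevant.
  | .below, .equal => 0
  | .below, .above => 0
  | .equal, .equal => 0
  | .equal, .above => 0
  | .above, .below => 0

/-- The first morphism of the factorization on page `k`. -/
noncomputable def inl (k : ℕ) : ∀ p, A.page k ⟶ page A B k p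
  | .below => Hom.hom f k
  | .equal => sumPathInl (A.page k) (B.page k)
  | .above => 𝟙 _

/-- The second morphism of the factorization on page `k`. -/
noncomputable def proj (k : ℕ) : ∀ p, page A B k p ⟶ B.page k
  | .below => 𝟙 _
  | .equal => sumPathDesc (Hom.hom f k)
  | .above => Hom.hom f k

lemma inl_proj (k : ℕ) (p : Position) : inl f k p ≫ proj f k p = Hom.hom f k :=
  match p with
  | .below => Category.comp_id _
  | .equal => sumPathInl_desc _
  | .above => Category.id_comp _

lemma inl_comm (k : ℕ) (i : ℤ × ℤ) {p q : Position} (h : p.Consecutive q) :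
    A.char k i ≫ homologyMap (inl f k q) i = (inl f (k + 1) p).f i ≫ char f k i p q := by
  cases h with
  | below_below => exact Hom.comm f k i
  | equal_below =>
    change A.char k i ≫ homologyMap (Hom.hom f k) i =
      (sumPathInl (A.page (k + 1)) (B.page (k + 1))).f i ≫
        (sumPathDesc (Hom.hom f (k + 1))).f i ≫ B.char k i
    rw [Hom.comm f k i, ← Category.assoc, ← comp_f, sumPathInl_desc]
  | above_equal => exact (Category.id_comp _).symm
  | above_above =>
    refine Eq.trans ?_ (Category.id_comp _).symm
    dsimp only [char, inl]
    exact (congrArg (A.char k i ≫ ·) (homologyMap_id _ _)).trans (Category.comp_id _)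

lemma proj_comm (k : ℕ) (i : ℤ × ℤ) {p q : Position} (h : p.Consecutive q) :
    char f k i p q ≫ homologyMap (proj f k q) i = (proj f (k + 1) p).f i ≫ B.char k i := by
  cases h with
  | below_below =>
    refine Eq.trans ?_ (Category.id_comp _).symm
    exact (congrArg (B.char k i ≫ ·) (homologyMap_id _ _)).trans (Category.comp_id _)
  | equal_below =>
    exact (congrArg (((sumPathDesc (Hom.hom f (k + 1))).f i ≫ B.char k i) ≫ ·)
      (homologyMap_id _ _)).trans (Category.comp_id _)
  | above_equal =>
    change (A.char k i ≫ homologyMap (sumPathInl (A.page k) (B.page k)) i) ≫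
      homologyMap (sumPathDesc (Hom.hom f k)) i = (Hom.hom f (k + 1)).f i ≫ B.char k i
    rw [Category.assoc, ← homologyMap_comp, sumPathInl_desc]
    exact Hom.comm f k i
  | above_above => exact Hom.comm f k i

end PathFactorization

/-- Weak equivalences ignore pages below `r` and fibrations ignore pages above `r`, so the middle
object can be `B` below and `A` above; only page `r` needs the contractible summand. The first
morphism need not be a cofibration. -/
lemma exists_factorization {A B : ExtendedSpectralSequence R} (f : A ⟶ B) (r : ℕ) :
    ∃ (P : ExtendedSpectralSequence R) (i : A ⟶ P) (p : P ⟶ B), i ≫ p = f ∧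
      quasiIsoIsoAbove R r i ∧ surjectiveUpTo R r p := by
  let P : ExtendedSpectralSequence R :=
    { page := fun k => PathFactorization.page A B k (position r k)
      char := fun k i => PathFactorization.char f k i _ _ }
  let i : A ⟶ P := Hom.mk (fun k => PathFactorization.inl f k _)
    fun k i => PathFactorization.inl_comm f k i (position_consecutive r k)
  let p : P ⟶ B := Hom.mk (fun k => PathFactorization.proj f k _)
    fun k i => PathFactorization.proj_comm f k i (position_consecutive r k)
  refine ⟨P, i, p, hom_ext fun k => PathFactorization.inl_proj f k _, ⟨?_, fun s hs => ?_⟩,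
    fun k hk j => ?_⟩
  · change QuasiIso (PathFactorization.inl f r (position r r))
    rw [position_self]
    exact HomologicalComplex.quasiIso_sumPathInl (rel_prev r) (rel_next r)
  · change IsIso (PathFactorization.inl f s (position r s))
    rw [position_of_gt hs]
    exact inferInstanceAs (IsIso (𝟙 _))
  · change Function.Surjective ((PathFactorization.proj f k (position r k)).f j)
    obtain hk | rfl := hk.lt_or_eq
    · rw [position_of_lt hk]
      exact Function.surjective_id
    · rw [position_self]
      exact HomologicalComplex.surjective_sumPathDesc _ _

/-! ### Weak equivalences, the retract argument and the model structure -/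

instance (r : ℕ) : (quasiIsoIsoAbove R r).IsStableUnderRetracts where
  of_retract h hg := ⟨MorphismProperty.of_retract
      (P := (HomologicalComplex.quasiIso _ _).inverseImage (pageFunctor R r)) h hg.1,
    fun s hs => MorphismProperty.of_retract
      (P := (MorphismProperty.isomorphisms _).inverseImage (pageFunctor R s)) h (hg.2 s hs)⟩

instance (r : ℕ) : (quasiIsoIsoAbove R r).HasTwoOutOfThreeProperty where
  comp_mem f g hf hg := ⟨MorphismProperty.comp_mem
      ((HomologicalComplex.quasiIso _ _).inverseImage (pageFunctor R r)) f g hf.1 hg.1,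
    fun s hs => MorphismProperty.comp_mem
      ((MorphismProperty.isomorphisms _).inverseImage (pageFunctor R s)) f g
        (hf.2 s hs) (hg.2 s hs)⟩
  of_postcomp f g hg hfg := ⟨MorphismProperty.of_postcomp
      (W' := (HomologicalComplex.quasiIso _ _).inverseImage (pageFunctor R r))
      ((HomologicalComplex.quasiIso _ _).inverseImage (pageFunctor R r)) f g hg.1 hfg.1,
    fun s hs => MorphismProperty.of_postcomp
      (W' := (MorphismProperty.isomorphisms _).inverseImage (pageFunctor R s))
      ((MorphismProperty.isomorphisms _).inverseImage (pageFunctor R s)) f g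
        (hg.2 s hs) (hfg.2 s hs)⟩
  of_precomp f g hf hfg := ⟨MorphismProperty.of_precomp
      (W' := (HomologicalComplex.quasiIso _ _).inverseImage (pageFunctor R r))
      ((HomologicalComplex.quasiIso _ _).inverseImage (pageFunctor R r)) f g hf.1 hfg.1,
    fun s hs => MorphismProperty.of_precomp
      (W' := (MorphismProperty.isomorphisms _).inverseImage (pageFunctor R s))
      ((MorphismProperty.isomorphisms _).inverseImage (pageFunctor R s)) f g
        (hf.2 s hs) (hfg.2 s hs)⟩

/-- Lifting against the fibration of `exists_factorization` makes `f` a retract of a weak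
equivalence. -/
lemma llp_surjectiveUpTo_le (r : ℕ) : (surjectiveUpTo R r).llp ≤ quasiIsoIsoAbove R r := by
  intro A B f hf
  obtain ⟨P, i, p, fac, hi, hp⟩ := exists_factorization f r
  have := hf p hp
  exact MorphismProperty.of_retract (RetractArrow.ofLeftLiftingProperty fac) hi

section

variable (R) (r : ℕ)

instance : MorphismProperty.HasFunctorialFactorization (surjectiveUpTo R r).llp
    (surjectiveUpTo R r) := by
  rw [← rlp_generatingTrivialCofibrations]
  infer_instance

instance : MorphismProperty.HasFunctorialFactorization
    (surjectiveUpTo R r ⊓ quasiIsoIsoAbove R r).llp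
    (surjectiveUpTo R r ⊓ quasiIsoIsoAbove R r) := by
  rw [← rlp_generatingCofibrations]
  infer_instance

lemma llp_inf_quasiIsoIsoAbove :
    (surjectiveUpTo R r ⊓ quasiIsoIsoAbove R r).llp ⊓ quasiIsoIsoAbove R r =
      (surjectiveUpTo R r).llp := by
  refine le_antisymm ?_ (le_inf (MorphismProperty.antitone_llp inf_le_left)
    (llp_surjectiveUpTo_le r))
  rintro A B f ⟨hf, hw⟩
  let d := MorphismProperty.factorizationData (surjectiveUpTo R r).llp (surjectiveUpTo R r) f
  -- By two-out-of-three the second factor is a trivial fibration, so `f` lifts against it and is a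
  -- retract of the first factor.
  have hp : quasiIsoIsoAbove R r d.p :=
    MorphismProperty.of_precomp _ d.i d.p (llp_surjectiveUpTo_le r _ d.hi) (by rwa [d.fac])
  have := hf d.p ⟨d.hp, hp⟩
  exact MorphismProperty.of_retract (RetractArrow.ofLeftLiftingProperty d.fac) d.hi

/-- The model category structure on extended spectral sequences. -/
noncomputable abbrev modelCategory : ModelCategory (ExtendedSpectralSequence R) :=
  letI : CategoryWithFibrations (ExtendedSpectralSequence R) := ⟨surjectiveUpTo R r⟩
  letI : CategoryWithCofibrations (ExtendedSpectralSequence R) :=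
    ⟨(surjectiveUpTo R r ⊓ quasiIsoIsoAbove R r).llp⟩
  letI : CategoryWithWeakEquivalences (ExtendedSpectralSequence R) := ⟨quasiIsoIsoAbove R r⟩
  haveI : (weakEquivalences (ExtendedSpectralSequence R)).HasTwoOutOfThreeProperty :=
    inferInstanceAs (quasiIsoIsoAbove R r).HasTwoOutOfThreeProperty
  haveI : MorphismProperty.IsWeakFactorizationSystem (cofibrations (ExtendedSpectralSequence R))
      (trivialFibrations (ExtendedSpectralSequence R)) :=
    { llp := rfl
      rlp := by
        change (surjectiveUpTo R r ⊓ quasiIsoIsoAbove R r).llp.rlp = _ ⊓ _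
        rw [← rlp_generatingCofibrations, MorphismProperty.rlp_llp_rlp,
          rlp_generatingCofibrations]
        rfl
      hasFactorization := inferInstanceAs (MorphismProperty.HasFactorization
        (surjectiveUpTo R r ⊓ quasiIsoIsoAbove R r).llp
        (surjectiveUpTo R r ⊓ quasiIsoIsoAbove R r)) }
  haveI : MorphismProperty.IsWeakFactorizationSystem
      (trivialCofibrations (ExtendedSpectralSequence R))
      (fibrations (ExtendedSpectralSequence R)) :=
    have h : trivialCofibrations (ExtendedSpectralSequence R) = (surjectiveUpTo R r).llp :=
      llp_inf_quasiIsoIsoAbove R r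
    { llp := h.symm
      rlp := by
        rw [h]
        change _ = surjectiveUpTo R r
        rw [← rlp_generatingTrivialCofibrations, MorphismProperty.rlp_llp_rlp]
      hasFactorization := by
        rw [h]
        exact inferInstanceAs (MorphismProperty.HasFactorization _ (surjectiveUpTo R r)) }
  ModelCategory.mk' _

end

end ExtendedSpectralSequence

theorem theoremT (R : Type u) [CommRing R] (r : ℕ) :
    HasLimits (ExtendedSpectralSequence R) ∧
    HasColimits (ExtendedSpectralSequence R) ∧
    ∃ _ : ModelCategory (ExtendedSpectralSequence R),
      fibrations (ExtendedSpectralSequence R) =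
        ExtendedSpectralSequence.surjectiveUpTo R r ∧
      weakEquivalences (ExtendedSpectralSequence R) =
        ExtendedSpectralSequence.quasiIsoIsoAbove R r ∧
      MorphismProperty.HasFunctorialFactorization
        (trivialCofibrations (ExtendedSpectralSequence R))
        (fibrations (ExtendedSpectralSequence R)) ∧
      MorphismProperty.HasFunctorialFactorization
        (cofibrations (ExtendedSpectralSequence R))
        (trivialFibrations (ExtendedSpectralSequence R)) := by
  refine ⟨inferInstance, inferInstance, ExtendedSpectralSequence.modelCategory R r, rfl, rfl,
    ?_, ?_⟩
  · change MorphismProperty.HasFunctorialFactorization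
      ((ExtendedSpectralSequence.surjectiveUpTo R r ⊓
        ExtendedSpectralSequence.quasiIsoIsoAbove R r).llp ⊓
          ExtendedSpectralSequence.quasiIsoIsoAbove R r)
      (ExtendedSpectralSequence.surjectiveUpTo R r)
    rw [ExtendedSpectralSequence.llp_inf_quasiIsoIsoAbove]
    infer_instance
  · exact inferInstanceAs (MorphismProperty.HasFunctorialFactorization
      (ExtendedSpectralSequence.surjectiveUpTo R r ⊓
        ExtendedSpectralSequence.quasiIsoIsoAbove R r).llp
      (ExtendedSpectralSequence.surjectiveUpTo R r ⊓
        ExtendedSpectralSequence.quasiIsoIsoAbove R r))
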